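/- A ring is called clean if each of its elements is the sum of a unit and an idempotent. Let $K=\mathbb{Q}(\sqrt d)$ with $d\neq 0,1$ a square-free integer, let $\Delta$ be the discriminant of $K$, $\mathcal O$ its ring of integers, $\mathfrak p\subset\mathcal O$ a nonzero prime ideal, $\mathcal O_{\mathfrak p}$ the localization of $\mathcal O$ at $\mathfrak p$, and $p$ the prime number with $\mathfrak p\cap\mathbb Z=p\mathbb Z$. Let $G$ be a finite abelian group and let $n$ be the largest positive divisor of $\exp(G)$ with $p\nmid n$. For $a$ coprime to $m\ge 1$, $\operatorname{ord}_m a$ denotes the order of $a$ in $(\mathbb Z/m\mathbb Z)^\times$, and $a$ is a primitive root of $m$ if $\operatorname{ord}_m a=\varphi(m)$. $\left(\frac{a}{p}\right)$ denotes the Legendre symbol if $p$ is odd, and the Kronecker symbol if $p=2$ (equal to $1$ if $a\equiv\pm1\pmod 8$, to $-1$ if $a\equiv\pm3\pmod 8$, and to $0$ if $a$ is even). $\mathbb N=\{1,2,\dots\}$. **1.** If $\Delta\nmid n$, then $\mathcal O_{\mathfrak p}[G]$ is clean if and only if one of the following holds: (a) $p=2$ is a primitive root of $n$ and $\Delta\not\equiv5\pmod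 8$; (b) $p\neq2$ is a primitive root of $n$ and $\left(\frac{\Delta}{p}\right)\in\{0,1\}$; (c) $n\in\{1,2\}$, $p\ne2$ and $\left(\frac{\Delta}{p}\right)=-1$; (d) $n=1$, $p=2$ and $\Delta\equiv5\pmod 8$. **2.** If $\Delta\mid n$, $d\equiv2,3\pmod 4$ and $d\neq-1$, then $\mathcal O_{\mathfrak p}[G]$ is clean if and only if $|d|$ is a prime, $n=4|d|^{\ell}$ for some $\ell\in\mathbb N$, $p\equiv3\pmod4$, $\left(\frac{\Delta}{p}\right)=1$ and $\operatorname{ord}_n p=\varphi(n)/2$. **2′.** If $\Delta\mid n$ and $d=-1$ (so $4\mid n$), write $n=2^{k+2}n_1$ with $k\ge0$ and $n_1$ odd. Then $\mathcal O_{\mathfrak p}[G]$ is clean if and only if $\operatorname{ord}_{n_1}p=\varphi(n_1)$, $\operatorname{ord}_{2^{k+2}}p=2^k\operatorname{ord}_4p$ and $\gcd(\operatorname{ord}_{n_1}p,\operatorname{ord}_{2^{k+2}}p)=1$. **3.** If $\Delta\mid n$ and $d\equiv1\pmod4$, then $\mathcal O_{\mathfrak p}[G]$ is clean if and only if one of the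 following holds: (a) $|d|$ is a prime, $n=|d|^\ell$ or $n=2|d|^\ell$ for some $\ell\in\mathbb N$, and either $\operatorname{ord}_np=\dfrac{2\varphi(n)}{3+\left(\frac dp\right)}$, or $\operatorname{ord}_np=\varphi(n)/2$ with $\left(\frac dp\right)=-1$ and $d<0$; (b) $|d|=q$ is a prime, $n=4q^\ell$ with $q\equiv3\pmod4$ and $\ell\in\mathbb N$, $\left(\frac dp\right)=1$, $p\equiv3\pmod4$, and $\operatorname{ord}_{q^\ell}p=q^{\ell-1}(q-1)/2$; (c) $|d|=q_1$ is a prime, $n=q_1^{\ell_1}q_2^{\ell_2}$ or $n=2q_1^{\ell_1}q_2^{\ell_2}$ with $q_1\equiv3\pmod4$, $\ell_1,\ell_2\in\mathbb N$ and $q_2\ne q_1$ another odd prime, $\left(\frac dp\right)=1$, $p$ is a primitive root of $q_2^{\ell_2}$, $\operatorname{ord}_{q_1^{\ell_1}}p=q_1^{\ell_1-1}(q_1-1)/2$, and $\gcd\bigl(q_1^{\ell_1-1}(q_1-1)/2,\;q_2^{\ell_2-1}(q_2-1)\bigr)=1$; (d) $|d|=q_1q_2$ is a product of two distinct primes, $n=q_1^{\ell_1}q_2^{\ell_2}$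 or $n=2q_1^{\ell_1}q_2^{\ell_2}$ with $\ell_1,\ell_2\in\mathbb N$, $\left(\frac dp\right)=1$, $p$ is a primitive root of $q_1^{\ell_1}$ and of $q_2^{\ell_2}$, and $\gcd\bigl(q_1^{\ell_1-1}(q_1-1)/2,\;q_2^{\ell_2-1}(q_2-1)/2\bigr)=1$. -/

import Mathlib

/-- A ring is clean if each of its elements is the sum of a unit and an idempotent. -/
def IsCleanRing (R : Type*) [Ring R] : Prop :=
  ∀ x : R, ∃ u e : R, IsUnit u ∧ IsIdempotentElem e ∧ x = u + e

/-- The multiplicative order of `a` modulo `n`, for `a` coprime to `n`.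
(It is `0` if `n ≠ 0` and `a` is not coprime to `n`.) -/
noncomputable def ordMod (n a : ℕ) : ℕ := orderOf (a : ZMod n)

/-- `a` is a primitive root of `n`: it is coprime to `n`, of order `φ(n)` modulo `n`. -/
def IsPrimitiveRootMod (n a : ℕ) : Prop := a.Coprime n ∧ ordMod n a = n.totient

/-- The symbol `(a/p)` for an arbitrary prime `p`: the Legendre symbol if `p` is odd, and the
Kronecker symbol if `p = 2`, i.e. `1` if `a ≡ ±1 (mod 8)`, `-1` if `a ≡ ±3 (mod 8)`,
`0` if `a` is even. -/
def primeSym (a : ℤ) (p : ℕ) [Fact p.Prime] : ℤ :=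
  if p = 2 then ZMod.χ₈ (a : ZMod 8) else legendreSym p a

/-!
Let `R = 𝓞_𝔭`, a local ring with residue field of size `q`, and let `ζ` be a primitive `n`-th root
of unity over `K`. The automorphisms of `K(ζ)` over `K` form a subgroup of `(ℤ/n)ˣ`, which contains
the class of `q` (`exists_algEquiv_apply_eq_pow_card`). The group ring `R[G]` is clean if and only
if `q` generates this subgroup:

* `R[ζ]` is a quotient of `R[G]`, and a clean domain is local. If `R[ζ]` is local, then `ζ` and any
  conjugate `σ ζ` have reductions that are conjugate over the residue field, so that `σ ζ` is
  `ζ ^ (q ^ j)` for some `j` (`galois_apply_eq_pow_of_isCleanRing`).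
* Conversely `R[G]` is semilocal, and its maximal ideals correspond to characters of the `n`-torsion
  of `G` up to powers of Frobenius. The sum of the idempotents of a Galois orbit of characters has
  coefficients in `R`. If all Galois automorphisms are powers of Frobenius, these sums separate the
  maximal ideals, which suffices for cleanness (`isCleanRing_monoidAlgebra_of_galois`,
  `isCleanRing_of_separated`).

Hence `R[G]` is clean if and only if `ordMod n q = [K(ζ) : K]`. For `K = ℚ(√d)` this degree is
`φ(n)/2` or `φ(n)` according to whether `√d` lies in `ℚ(ζ)`, which holds if and only if the
discriminant `Δ` divides `n`. Gauss sums give the square roots (`exists_sq_eq_of_discr_dvd`). In the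
other direction, an element `√d` of `ℚ(ζ)` would make `d` a square modulo almost all primes
`l ≡ 1 (mod n)`, against quadratic reciprocity and Dirichlet's theorem (`discr_dvd_of_mem_adjoin`).
From `𝓞 = ℤ[θ]` one reads off `Δ` and `q`, which is `p²` if `p` is inert and `p` otherwise
(`discr_eq`, `card_quotient`). The result is `isCleanRing_localization_iff_ordMod`.

What remains is elementary: to decide when `p` or `p²` has index one or two modulo `n`. The order
modulo a product of coprime numbers is the least common multiple of the orders, and `φ` is even
beyond `2`, so that index two forces `n`, up to a factor `2`, to be a power of `2`, a product of at
most two odd prime powers, or `4` times an odd prime power (`two_mul_ordMod_mul_iff`,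
`exists_eq_prime_pow`). The values of the symbol `(Δ/p)` exclude the configurations in
which `p` would be both a square and a primitive root modulo an odd prime.
-/

/-! ### Clean rings with finitely many maximal ideals -/

section
open IsLocalRing

theorem IsCleanRing.of_surjective {A B : Type*} [Ring A] [Ring B] (f : A →+* B)
    (hf : Function.Surjective f) (hA : IsCleanRing A) : IsCleanRing B := by
  intro y
  obtain ⟨x, rfl⟩ := hf y
  obtain ⟨u, e, hu, he, rfl⟩ := hA x
  exact ⟨f u, f e, hu.map f, he.map f, map_add f u e⟩

/-- The only idempotents of a domain are `0` and `1`, so a clean domain is local. -/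
theorem IsCleanRing.isLocalRing {A : Type*} [CommRing A] [IsDomain A] (hA : IsCleanRing A) :
    IsLocalRing A := by
  refine IsLocalRing.of_isUnit_or_isUnit_one_sub_self fun a => ?_
  obtain ⟨u, e, hu, he, rfl⟩ := hA a
  rcases IsIdempotentElem.iff_eq_zero_or_one.mp he with rfl | rfl
  · left; simpa using hu
  · right; simpa using hu.neg

/-- A semilocal ring is clean as soon as any two of its maximal ideals are separated by an
idempotent: such idempotents give one that is `1` exactly at the maximal ideals containing a given
`x`, and `x` minus this idempotent lies in no maximal ideal. -/
theorem isCleanRing_of_separated {A : Type*} [CommRing A] [Finite (MaximalSpectrum A)]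
    (h : ∀ M N : MaximalSpectrum A, M ≠ N →
      ∃ e : A, IsIdempotentElem e ∧ e ∈ M.asIdeal ∧ 1 - e ∈ N.asIdeal) : IsCleanRing A := by
  classical
  have := Fintype.ofFinite (MaximalSpectrum A)
  intro x
  choose! e he heM heN using h
  -- `F N` is an idempotent that lies in every maximal ideal but `N`
  let F : MaximalSpectrum A → A := fun N => ∏ M ∈ Finset.univ.erase N, e M N
  have hF : ∀ N, IsIdempotentElem (F N) := fun N => by
    have : F N * F N = F N := by
      simp only [F]
      rw [← Finset.prod_mul_distrib]
      exact Finset.prod_congr rfl fun M hM => he M N (Finset.ne_of_mem_erase hM)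
    exact this
  have hFM : ∀ N M, M ≠ N → F N ∈ M.asIdeal := fun N M hMN =>
    Ideal.mem_of_dvd _ (Finset.dvd_prod_of_mem (fun M => e M N) (by simpa using hMN))
      (heM M N hMN)
  have hFN : ∀ N, 1 - F N ∈ N.asIdeal := fun N => by
    rw [← Ideal.Quotient.eq_zero_iff_mem, map_sub, map_one, map_prod, sub_eq_zero]
    refine (Finset.prod_eq_one fun M hM => ?_).symm
    have := heN M N (Finset.ne_of_mem_erase hM)
    rw [← Ideal.Quotient.eq_zero_iff_mem, map_sub, map_one, sub_eq_zero] at this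
    exact this.symm
  -- the idempotent that is `1` at the maximal ideals containing `x` and `0` at the others
  let T : Finset (MaximalSpectrum A) := Finset.univ.filter fun N => x ∈ N.asIdeal
  let E : A := 1 - ∏ N ∈ T, (1 - F N)
  have hE : IsIdempotentElem E := by
    refine IsIdempotentElem.one_sub ?_
    change _ * _ = _
    rw [← Finset.prod_mul_distrib]
    exact Finset.prod_congr rfl fun N _ => (hF N).one_sub
  refine ⟨x - E, E, ?_, hE, by ring⟩
  by_contra hu
  obtain ⟨M, hM, hxM⟩ := exists_max_ideal_of_mem_nonunits hu
  let M' : MaximalSpectrum A := ⟨M, hM⟩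
  by_cases hx : x ∈ M
  · have h1 : ∏ N ∈ T, (1 - F N) ∈ M :=
      Ideal.mem_of_dvd _ (Finset.dvd_prod_of_mem _ (by simpa [T] using hx : M' ∈ T)) (hFN M')
    have h2 := M.add_mem (M.sub_mem hx hxM) h1
    exact hM.ne_top (M.eq_top_of_isUnit_mem h2 (by simp [E]))
  · have h1 : E ∈ M := by
      rw [← Ideal.Quotient.eq_zero_iff_mem, map_sub, map_one, map_prod, sub_eq_zero]
      refine (Finset.prod_eq_one fun N hN => ?_).symm
      have hne : M' ≠ N := by
        rintro rfl
        simp [T, M'] at hN; exact hx hN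
      have := hFM N M' hne
      rw [map_sub, map_one, Ideal.Quotient.eq_zero_iff_mem.mpr this, sub_zero]
    exact hx (by simpa using M.add_mem hxM h1)

section LocalBase
variable {R : Type*} [CommRing R] [IsLocalRing R]

/-- A module-finite algebra over a local ring is semilocal. -/
theorem finite_maximalSpectrum (A : Type*) [CommRing A] [Algebra R A] [Module.Finite R A] :
    Finite (MaximalSpectrum A) := by
  have := Algebra.QuasiFinite.finite_primesOver (S := A) (maximalIdeal R)
  have := this.to_subtype
  refine Finite.of_injective
    (fun M : MaximalSpectrum A => (⟨M.asIdeal, M.isMaximal.isPrime, ⟨?_⟩⟩ :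
      (maximalIdeal R).primesOver A)) ?_
  · exact (IsLocalRing.eq_maximalIdeal
      (Ideal.isMaximal_comap_of_isIntegral_of_isMaximal (R := R) M.asIdeal)).symm
  · intro M N h
    ext1
    exact congrArg Subtype.val h

/-- The residue field at a maximal ideal of an integral algebra over a local ring embeds into the
algebraic closure of the residue field of the base. -/
theorem exists_algHom_ker_eq {A : Type*} [CommRing A] [Algebra R A] [Algebra.IsIntegral R A]
    (M : Ideal A) [M.IsMaximal] :
    ∃ f : A →ₐ[R] AlgebraicClosure (ResidueField R), RingHom.ker f = M := by
  have hM : M.LiesOver (maximalIdeal R) :=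
    ⟨(IsLocalRing.eq_maximalIdeal
      (Ideal.isMaximal_comap_of_isIntegral_of_isMaximal (R := R) M)).symm⟩
  let _ : Field (A ⧸ M) := Ideal.Quotient.field M
  let _ : Algebra (ResidueField R) (A ⧸ M) :=
    inferInstanceAs (Algebra (R ⧸ maximalIdeal R) (A ⧸ M))
  have : IsScalarTower R (ResidueField R) (A ⧸ M) :=
    inferInstanceAs (IsScalarTower R (R ⧸ maximalIdeal R) (A ⧸ M))
  have : Algebra.IsIntegral R (A ⧸ M) := inferInstance
  have : Algebra.IsIntegral (ResidueField R) (A ⧸ M) := Algebra.IsIntegral.tower_top R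
  have : Algebra.IsAlgebraic (ResidueField R) (A ⧸ M) := inferInstance
  let f : (A ⧸ M) →ₐ[ResidueField R] AlgebraicClosure (ResidueField R) := IsAlgClosed.lift
  refine ⟨(f.restrictScalars R).comp (Ideal.Quotient.mkₐ R M), ?_⟩
  ext x
  simp [RingHom.mem_ker, Ideal.Quotient.eq_zero_iff_mem]

end LocalBase

end

/-! ### Roots of unity, Galois automorphisms and Frobenius -/

section
open IsLocalRing Polynomial

section RootsOfUnity
variable {B Ω : Type*} [CommRing B] [IsDomain B] [Field Ω] (f : B →+* Ω) {n : ℕ}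

/-- A ring homomorphism to a field in which `n` is nonzero is injective on `n`-th roots of unity. -/
theorem eq_of_pow_eq_one_of_map_eq (hn : (n : Ω) ≠ 0) {x y : B} (hx : x ^ n = 1) (hy : y ^ n = 1)
    (h : f x = f y) : x = y := by
  have hn0 : n ≠ 0 := by rintro rfl; simp at hn
  have hy' : y * y ^ (n - 1) = 1 := by rw [← pow_succ', Nat.sub_add_cancel (by lia), hy]
  set u := x * y ^ (n - 1) with hu
  have hun : u ^ n = 1 := by
    rw [hu, mul_pow, hx, one_mul, ← pow_mul, mul_comm, pow_mul, hy, one_pow]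
  have hfu : f u = 1 := by rw [hu, map_mul, h, ← map_mul, hy', map_one]
  suffices u = 1 by
    calc x = x * (y * y ^ (n - 1)) := by rw [hy', mul_one]
      _ = u * y := by rw [hu]; ring
      _ = y := by rw [this, one_mul]
  by_contra hne
  have h0 : (∑ i ∈ Finset.range n, u ^ i) * (u - 1) = 0 := by rw [geom_sum_mul, hun, sub_self]
  have h1 := (mul_eq_zero.mp h0).resolve_right (sub_ne_zero.mpr hne)
  apply hn
  have := congrArg f h1
  simpa [hfu] using this

theorem IsPrimitiveRoot.map_of_natCast_ne_zero {ζ : B} (hζ : IsPrimitiveRoot ζ n)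
    (hn : (n : Ω) ≠ 0) : IsPrimitiveRoot (f ζ) n := by
  refine ⟨by rw [← map_pow, hζ.pow_eq_one, map_one], fun l hl => hζ.dvd_of_pow_eq_one _ ?_⟩
  refine eq_of_pow_eq_one_of_map_eq f hn ?_ (one_pow _) (by rw [map_pow, hl, map_one])
  rw [← pow_mul, mul_comm, pow_mul, hζ.pow_eq_one, one_pow]

end RootsOfUnity

section FiniteField
variable {k Ω : Type*} [Field k] [Finite k] [Field Ω] [Algebra k Ω]

/-- Conjugate elements over a finite field differ by a power of Frobenius. -/
theorem exists_pow_eq_of_minpoly_eq [Algebra.IsAlgebraic k Ω] {x y : Ω}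
    (h : aeval y (minpoly k x) = 0) : ∃ j : ℕ, y = x ^ (Nat.card k ^ j) := by
  classical
  have := Fintype.ofFinite k
  let F := IntermediateField.adjoin k ({x, y} : Set Ω)
  have : FiniteDimensional k F := IntermediateField.finiteDimensional_adjoin
    fun z _ => (Algebra.IsAlgebraic.isAlgebraic (R := k) z).isIntegral
  have : Finite F := Module.finite_of_finite k
  let x' : F := ⟨x, IntermediateField.subset_adjoin _ _ (by simp)⟩
  let y' : F := ⟨y, IntermediateField.subset_adjoin _ _ (by simp)⟩
  have hm : minpoly k x' = minpoly k x := by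
    rw [← minpoly.algebraMap_eq (algebraMap F Ω).injective x']; rfl
  have hy : aeval y' (minpoly k x') = 0 := by
    apply (algebraMap F Ω).injective
    rw [map_zero, ← aeval_algebraMap_apply, hm]; exact h
  obtain ⟨σ, hσ⟩ := minpoly.exists_algEquiv_of_root
    (Algebra.IsAlgebraic.isAlgebraic (R := k) x') hy
  obtain ⟨j, hj⟩ := (FiniteField.bijective_frobeniusAlgEquivOfAlgebraic_pow k F).2 σ.symm
  refine ⟨(j : ℕ), ?_⟩
  have h2 : y' = x' ^ (Nat.card k ^ (j : ℕ)) := by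
    rw [← (σ.symm_apply_eq.mpr hσ.symm : σ.symm x' = y'), ← hj, AlgEquiv.coe_pow,
      FiniteField.coe_frobeniusAlgEquivOfAlgebraic, pow_iterate, Nat.card_eq_fintype_card]
  exact congrArg Subtype.val h2
end FiniteField

section Galois
variable {R K L : Type*} [CommRing R] [Field K] [Algebra R K]
  [Field L] [Algebra K L] [Algebra R L] [IsScalarTower R K L]

/-- The restriction of a Galois automorphism to the integral closure of the base ring. -/
noncomputable def integralClosureMap (σ : L ≃ₐ[K] L) :
    integralClosure R L →ₐ[R] integralClosure R L :=
  (((σ : L →ₐ[K] L).restrictScalars R).comp (integralClosure R L).val).codRestrict _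
    fun x => x.2.map ((σ : L →ₐ[K] L).restrictScalars R)

@[simp]
theorem coe_integralClosureMap (σ : L ≃ₐ[K] L) (x : integralClosure R L) :
    (integralClosureMap σ x : L) = σ x := rfl

theorem exists_algebraMap_eq_of_fixed [IsIntegrallyClosed R] [IsFractionRing R K]
    [FiniteDimensional K L] [IsGalois K L] {x : L} (hx : IsIntegral R x)
    (h : ∀ σ : L ≃ₐ[K] L, σ x = x) : ∃ r : R, algebraMap R L r = x := by
  obtain ⟨y, rfl⟩ := IntermediateField.mem_bot.mp ((IsGalois.mem_bot_iff_fixed x).mpr h)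
  have hy : IsIntegral R y :=
    (isIntegral_algHom_iff (IsScalarTower.toAlgHom R K L) (algebraMap K L).injective).mp hx
  obtain ⟨r, rfl⟩ := IsIntegrallyClosed.isIntegral_iff.mp hy
  exact ⟨r, IsScalarTower.algebraMap_apply R K L r⟩

variable [IsLocalRing R]

theorem natCast_algebraicClosure_ne_zero {n : ℕ} (hn : (n : ResidueField R) ≠ 0) :
    (n : AlgebraicClosure (ResidueField R)) ≠ 0 := by
  rw [← map_natCast (algebraMap (ResidueField R) (AlgebraicClosure (ResidueField R)))]
  exact fun h => hn ((map_eq_zero _).mp h)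

/-- The Frobenius endomorphism `x ↦ x ^ q` of the algebraic closure of the residue field, where `q`
is the size of the residue field. It is linear over `R`, so that it acts on the `R`-algebra maps
from the group ring to this algebraic closure. -/
noncomputable def residueFrobenius (R : Type*) [CommRing R] [IsLocalRing R]
    [Finite (ResidueField R)] :
    AlgebraicClosure (ResidueField R) →ₐ[R] AlgebraicClosure (ResidueField R) :=
  letI := Fintype.ofFinite (ResidueField R)
  (FiniteField.frobeniusAlgHom (ResidueField R)
    (AlgebraicClosure (ResidueField R))).restrictScalars R

theorem residueFrobenius_apply [Finite (ResidueField R)]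
    (x : AlgebraicClosure (ResidueField R)) :
    residueFrobenius R x = x ^ Nat.card (ResidueField R) := by
  simp [residueFrobenius, ← Nat.card_eq_fintype_card]

theorem residueFrobenius_pow_apply [Finite (ResidueField R)] (j : ℕ)
    (x : AlgebraicClosure (ResidueField R)) :
    (residueFrobenius R ^ j) x = x ^ (Nat.card (ResidueField R) ^ j) := by
  induction j with
  | zero => simp
  | succ j ih => rw [pow_succ', AlgHom.mul_apply, ih, residueFrobenius_apply, ← pow_mul, pow_succ]

variable [Finite (ResidueField R)]
variable [IsIntegrallyClosed R] [IsFractionRing R K] [FiniteDimensional K L] [IsGalois K L]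
  {n : ℕ} [NeZero n]

/-- Existence of a Frobenius element: the power map by the size of the residue field is induced
by a Galois automorphism on the `n`-th roots of unity, because it permutes the roots of the
reduction of the minimal polynomial of `ζ`. -/
theorem exists_algEquiv_apply_eq_pow_card (hn : (n : ResidueField R) ≠ 0) {ζ : L}
    (hζ : IsPrimitiveRoot ζ n) : ∃ σ : L ≃ₐ[K] L, σ ζ = ζ ^ Nat.card (ResidueField R) := by
  classical
  have hint : IsIntegral R ζ := (hζ.isIntegral (NeZero.pos n)).tower_top
  let Z : integralClosure R L := ⟨ζ, hint⟩
  have hZn : Z ^ n = 1 := Subtype.ext hζ.pow_eq_one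
  -- reduction modulo a prime above the maximal ideal is injective on `n`-th roots of unity
  obtain ⟨Q, hQ⟩ := Ideal.exists_maximal (integralClosure R L)
  obtain ⟨β, -⟩ := exists_algHom_ker_eq (R := R) Q
  set q := Nat.card (ResidueField R)
  -- the polynomial whose roots are the conjugates of `ζ`
  let P : (integralClosure R L)[X] := ∏ σ : L ≃ₐ[K] L, (X - C (integralClosureMap σ Z))
  -- `P` is Galois invariant, hence has coefficients in the integrally closed ring `R`
  have hP : P ∈ lifts (algebraMap R (integralClosure R L)) := by
    rw [lifts_iff_coeff_lifts]
    intro i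
    obtain ⟨r, hr⟩ := exists_algebraMap_eq_of_fixed (R := R) (K := K) (P.coeff i).2 (by
      intro τ
      have hτ : P.map (integralClosureMap (R := R) τ : integralClosure R L →+* _) = P := by
        simp only [P, Polynomial.map_prod, Polynomial.map_sub, map_X, map_C]
        refine Fintype.prod_equiv (Equiv.mulLeft τ) _ _ fun σ => ?_
        congr 2
      calc τ (P.coeff i : L) = ((P.map (integralClosureMap (R := R) τ :
            integralClosure R L →+* _)).coeff i : integralClosure R L) := by
              rw [coeff_map]; rfl
        _ = _ := by rw [hτ])
    exact ⟨r, Subtype.ext hr⟩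
  obtain ⟨m, hm⟩ := hP
  have hm : m.map (algebraMap R (integralClosure R L)) = P := hm
  have heval : ∀ y : AlgebraicClosure (ResidueField R),
      aeval y m = ∏ σ : L ≃ₐ[K] L, (y - β (integralClosureMap σ Z)) := fun y => by
    have : aeval y m = eval₂ (β : integralClosure R L →+* _) y P := by
      rw [← hm, eval₂_map, aeval_def]
      congr 1
      ext r; simp
    rw [this, eval₂_finsetProd]
    simp
  have h0 : aeval (β Z) m = 0 := by
    rw [heval]
    exact Finset.prod_eq_zero (Finset.mem_univ 1) (sub_eq_zero.mpr (by congr 1))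
  have h1 : aeval (β Z ^ q) m = 0 := by
    rw [← residueFrobenius_apply, aeval_algHom_apply, h0, map_zero]
  rw [heval, Finset.prod_eq_zero_iff] at h1
  obtain ⟨σ, -, hσ⟩ := h1
  refine ⟨σ, ?_⟩
  have : Z ^ q = integralClosureMap σ Z :=
    eq_of_pow_eq_one_of_map_eq (β : integralClosure R L →+* _)
      (natCast_algebraicClosure_ne_zero hn)
      (by rw [← pow_mul, mul_comm, pow_mul, hZn, one_pow])
      (by rw [← map_pow, hZn, map_one])
      (by simpa [sub_eq_zero] using hσ)
  exact (congrArg Subtype.val this).symm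
end Galois

end

/-! ### Cleanness makes the Galois group cyclic, generated by Frobenius -/

section
open IsLocalRing Polynomial

/-- A finite abelian group of exponent `n` has a character sending a given element of order `n` to
a given primitive `n`-th root of unity. -/
theorem exists_monoidHom_units_apply_eq {H L : Type*} [CommGroup H] [Finite H] [Field L] {n : ℕ}
    [NeZero n] (hH : Monoid.exponent H = n) {ζ : L} (hζ : IsPrimitiveRoot ζ n) {h : H}
    (hh : orderOf h = n) : ∃ χ : H →* Lˣ, (χ h : L) = ζ := by
  have : HasEnoughRootsOfUnity L n := ⟨⟨ζ, hζ⟩, inferInstance⟩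
  subst hH
  obtain ⟨ζ, rfl⟩ := hζ.isUnit (NeZero.ne _)
  have hζ := IsPrimitiveRoot.coe_units_iff.mp hζ
  let h' : Subgroup.zpowers h := ⟨h, Subgroup.mem_zpowers h⟩
  let ζ' : Subgroup.zpowers ζ := ⟨ζ, Subgroup.mem_zpowers ζ⟩
  have h1 : ∀ x, x ∈ Subgroup.zpowers h' := by
    rintro ⟨_, i, rfl⟩
    exact ⟨i, rfl⟩
  have h2 : ∀ x, x ∈ Subgroup.zpowers ζ' := by
    rintro ⟨_, i, rfl⟩
    exact ⟨i, rfl⟩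
  let e := mulEquivOfOrderOfEq h1 h2 (by
    rw [Subgroup.orderOf_mk, Subgroup.orderOf_mk, hh, ← hζ.eq_orderOf])
  obtain ⟨χ, hχ⟩ := MonoidHom.domRestrict_surjective L (Subgroup.zpowers h)
    ((Subgroup.zpowers ζ).subtype.comp e.toMonoidHom)
  refine ⟨χ, ?_⟩
  have := DFunLike.congr_fun hχ h'
  simp only [MonoidHom.coe_comp, Function.comp_apply] at this
  change χ h = ((e h' : Subgroup.zpowers ζ) : Lˣ) at this
  rw [this, mulEquivOfOrderOfEq_apply_gen]

theorem isMaximal_ker_algHom {R A : Type*} [CommRing R] [IsLocalRing R] [CommRing A] [Algebra R A]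
    [Algebra.IsIntegral R A] (f : A →ₐ[R] AlgebraicClosure (ResidueField R)) :
    (RingHom.ker f).IsMaximal := by
  have : (RingHom.ker f).IsPrime := RingHom.ker_isPrime _
  apply Ideal.isMaximal_of_isIntegral_of_isMaximal_comap (R := R)
  have : (RingHom.ker f).comap (algebraMap R A) = maximalIdeal R := by
    ext r
    rw [Ideal.mem_comap, RingHom.mem_ker, AlgHom.commutes,
      IsScalarTower.algebraMap_apply R (ResidueField R), map_eq_zero, ResidueField.algebraMap_eq,
      residue_eq_zero_iff]
  rw [this]
  infer_instance

section Clean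
variable {R K L : Type*} [CommRing R] [Field K] [Algebra R K]
  [Field L] [Algebra K L] [Algebra R L] [IsScalarTower R K L]
  {n : ℕ} [NeZero n] {G : Type*} [CommGroup G] [Finite G]

/-- The algebra map extends a character of `G` of order `n` to the group ring. -/
theorem exists_algHom_monoidAlgebra_apply_eq {m : ℕ}
    (hG : Monoid.exponent G = m * n) {ζ : L} (hζ : IsPrimitiveRoot ζ n) :
    ∃ (φ : MonoidAlgebra R G →ₐ[R] L) (x : MonoidAlgebra R G), φ x = ζ := by
  let H : Subgroup G := (powMonoidHom n : G →* G).ker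
  have hm : m ≠ 0 := by
    rintro rfl
    exact Monoid.exponent_ne_zero_of_finite (G := G) (by simpa using hG)
  let ρ : G →* H := (powMonoidHom m : G →* G).codRestrict H fun g => by
    simp only [H, MonoidHom.mem_ker, powMonoidHom_apply]
    rw [← pow_mul, ← hG, Monoid.pow_exponent_eq_one]
  obtain ⟨g, hg⟩ := Monoid.exists_orderOf_eq_exponent (Monoid.ExponentExists.of_finite (G := G))
  have hρ : orderOf (ρ g) = n := by
    rw [← Subgroup.orderOf_coe]
    change orderOf (g ^ m) = n
    rw [orderOf_pow_of_dvd hm (by rw [hg, hG]; exact dvd_mul_right _ _), hg, hG,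
      Nat.mul_div_cancel_left _ (Nat.pos_of_ne_zero hm)]
  have hH : Monoid.exponent H = n := by
    refine Nat.dvd_antisymm (Monoid.exponent_dvd_of_forall_pow_eq_one fun x => Subtype.ext x.2) ?_
    rw [← hρ]
    exact Monoid.order_dvd_exponent _
  obtain ⟨χ, hχ⟩ := exists_monoidHom_units_apply_eq hH hζ hρ
  refine ⟨MonoidAlgebra.lift R L G ((Units.coeHom L).comp (χ.comp ρ)), MonoidAlgebra.of R G g, ?_⟩
  simpa using hχ

variable [IsLocalRing R] [Finite (ResidueField R)]

/-- If the group ring is clean, so is its image in the integral closure of `R` that contains `ζ`;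
being a domain, this image is local. Two reductions of it, one of them twisted by `σ`, therefore
have the same kernel, and the reductions of `ζ` and `σ ζ` are conjugate over the finite residue
field. -/
theorem galois_apply_eq_pow_of_isCleanRing {m : ℕ}
    (hG : Monoid.exponent G = m * n) (hn : (n : ResidueField R) ≠ 0) {ζ : L}
    (hζ : IsPrimitiveRoot ζ n) (hclean : IsCleanRing (MonoidAlgebra R G)) (σ : L ≃ₐ[K] L) :
    ∃ j : ℕ, σ ζ = ζ ^ (Nat.card (ResidueField R) ^ j) := by
  obtain ⟨φ, x, hx⟩ := exists_algHom_monoidAlgebra_apply_eq (R := R) hG hζ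
  have hint : IsIntegral R ζ := (hζ.isIntegral (NeZero.pos n)).tower_top
  let Z : integralClosure R L := ⟨ζ, hint⟩
  have hZn : Z ^ n = 1 := Subtype.ext hζ.pow_eq_one
  obtain ⟨Q, hQ⟩ := Ideal.exists_maximal (integralClosure R L)
  obtain ⟨β, -⟩ := exists_algHom_ker_eq (R := R) Q
  let φ' : MonoidAlgebra R G →ₐ[R] integralClosure R L :=
    φ.codRestrict _ fun y => (Algebra.IsIntegral.isIntegral y).map φ
  have hφx : φ' x = Z := Subtype.ext hx
  have := (hclean.of_surjective φ'.rangeRestrict.toRingHom φ'.rangeRestrict_surjective).isLocalRing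
  have : Algebra.IsIntegral R φ'.range :=
    .of_surjective φ'.rangeRestrict φ'.rangeRestrict_surjective
  let C := φ'.range
  -- all reductions of the local ring `C` have the same kernel
  have hC : ∀ f : C →ₐ[R] AlgebraicClosure (ResidueField R), RingHom.ker f = maximalIdeal C :=
    fun f => IsLocalRing.eq_maximalIdeal (isMaximal_ker_algHom f)
  let f₁ : C →ₐ[R] AlgebraicClosure (ResidueField R) := β.comp C.val
  let f₂ : C →ₐ[R] AlgebraicClosure (ResidueField R) :=
    (β.comp (integralClosureMap σ)).comp C.val
  let c : C := ⟨Z, x, hφx⟩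
  obtain ⟨j, hj⟩ : ∃ j : ℕ, f₂ c = f₁ c ^ (Nat.card (ResidueField R) ^ j) := by
    apply exists_pow_eq_of_minpoly_eq
    obtain ⟨g, hg⟩ := Polynomial.map_surjective (residue R) IsLocalRing.residue_surjective
      (minpoly (ResidueField R) (f₁ c))
    have key : ∀ f : C →ₐ[R] AlgebraicClosure (ResidueField R),
        aeval (f c) (minpoly (ResidueField R) (f₁ c)) = f (aeval c g) := fun f => by
      rw [← hg, ← aeval_algHom_apply]
      exact aeval_map_algebraMap (ResidueField R) (f c) g
    have h1 : aeval c g ∈ RingHom.ker f₁ := by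
      rw [RingHom.mem_ker]
      exact (key f₁).symm.trans (minpoly.aeval _ _)
    rw [hC, ← hC f₂] at h1
    rw [key f₂]; exact h1
  refine ⟨j, ?_⟩
  have : integralClosureMap σ Z = Z ^ (Nat.card (ResidueField R) ^ j) :=
    eq_of_pow_eq_one_of_map_eq (β : integralClosure R L →+* _)
      (natCast_algebraicClosure_ne_zero hn)
      (by rw [← map_pow, hZn, map_one])
      (by rw [← pow_mul, mul_comm, pow_mul, hZn, one_pow])
      (by rw [map_pow]; exact hj)
  exact congrArg Subtype.val this

end Clean

end

/-! ### Idempotents attached to Galois orbits of characters -/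

section
open IsLocalRing Polynomial

section Orthogonality
variable {H B : Type*} [CommGroup H] [Fintype H] [CommRing B] [IsDomain B]

open Classical in
/-- Orthogonality of the characters of `H` with values in a domain. -/
theorem sum_apply_inv_mul_apply (χ ψ : H →* B) :
    ∑ h, χ h⁻¹ * ψ h = if χ = ψ then (Fintype.card H : B) else 0 := by
  have key : ∀ h, χ h⁻¹ * ψ h = (χ.comp invMonoidHom * ψ) h := fun h => rfl
  have hinv : ∀ h, χ h⁻¹ * χ h = 1 := fun h => by rw [← map_mul, inv_mul_cancel, map_one]
  split_ifs with h
  · subst h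
    simp [hinv]
  · simp_rw [key]
    refine sum_hom_units_eq_zero _ fun h1 => h ?_
    ext x
    have := DFunLike.congr_fun h1 x
    rw [← key, MonoidHom.one_apply] at this
    calc χ x = χ x * (χ x⁻¹ * ψ x) := by rw [this, mul_one]
      _ = (χ x⁻¹ * χ x) * ψ x := by ring
      _ = ψ x := by rw [hinv, one_mul]

/-- The coefficient at `h` of the idempotent `∑_{χ ∈ S} (1/|H|) ∑_h χ(h⁻¹) h` attached to a finite
set `S` of characters; `v` stands for `1/|H|`. -/
def idempotentCoeff (v : B) (S : Finset (H →* B)) (h : H) : B := v * ∑ χ ∈ S, χ h⁻¹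

variable {v : B} (hv : v * (Fintype.card H : B) = 1) (S : Finset (H →* B))
include hv

open Classical in
theorem sum_idempotentCoeff_mul_apply (ψ : H →* B) :
    ∑ h, idempotentCoeff v S h * ψ h = if ψ ∈ S then 1 else 0 := by
  simp_rw [idempotentCoeff, mul_assoc, Finset.sum_mul, ← Finset.mul_sum]
  rw [Finset.sum_comm]
  simp_rw [sum_apply_inv_mul_apply]
  rw [Finset.sum_ite_eq' S ψ]
  split_ifs <;> simp [hv]

/-- The convolution square of the coefficients, that is, the element they define is idempotent. -/
theorem sum_idempotentCoeff_mul_idempotentCoeff (h : H) :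
    ∑ g, idempotentCoeff v S g * idempotentCoeff v S (g⁻¹ * h) = idempotentCoeff v S h := by
  classical
  have : ∀ g, idempotentCoeff v S g * idempotentCoeff v S (g⁻¹ * h) =
      ∑ ψ ∈ S, v * ψ h⁻¹ * (idempotentCoeff v S g * ψ g) := fun g => by
    conv_lhs => rw [idempotentCoeff.eq_1 v S (g⁻¹ * h), Finset.mul_sum, Finset.mul_sum]
    refine Finset.sum_congr rfl fun ψ _ => ?_
    rw [mul_inv, inv_inv, map_mul]; ring
  simp_rw [this]
  rw [Finset.sum_comm]
  simp_rw [← Finset.mul_sum, sum_idempotentCoeff_mul_apply hv]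
  rw [idempotentCoeff, Finset.mul_sum]
  exact Finset.sum_congr rfl fun ψ hψ => by rw [if_pos hψ, mul_one]

end Orthogonality

section Clean
variable {R K L : Type*} [CommRing R] [Field K] [Algebra R K]
  [Field L] [Algebra K L] [Algebra R L] [IsScalarTower R K L]
  [IsLocalRing R] [IsIntegrallyClosed R] [IsFractionRing R K] [FiniteDimensional K L] [IsGalois K L]

variable {H : Type*} [CommGroup H] [Fintype H]

/-- The idempotent of the group ring over `R` that cuts out the Galois orbit of a character. -/
theorem exists_idempotent_of_orbit (hH : (Fintype.card H : ResidueField R) ≠ 0)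
    (χ : H →* integralClosure R L) :
    ∃ r : H → R, (∀ h, ∑ g, r g * r (g⁻¹ * h) = r h) ∧
      (∑ h, algebraMap R (integralClosure R L) (r h) * χ h = 1) ∧
      ∀ ψ : H →* integralClosure R L,
        (∀ σ : L ≃ₐ[K] L, ψ ≠ (integralClosureMap (R := R) σ : _ →* _).comp χ) →
        ∑ h, algebraMap R (integralClosure R L) (r h) * ψ h = 0 := by
  classical
  have hu : IsUnit (Fintype.card H : R) := by
    have := (residue_ne_zero_iff_isUnit (Fintype.card H : R)).mp (by simpa using hH)
    exact this
  obtain ⟨v, hv⟩ := hu.exists_left_inv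
  let act (σ : L ≃ₐ[K] L) : (H →* integralClosure R L) → (H →* integralClosure R L) :=
    fun ψ => (integralClosureMap (R := R) σ : _ →* _).comp ψ
  let S : Finset (H →* integralClosure R L) := Finset.univ.image fun σ : L ≃ₐ[K] L => act σ χ
  have hv' : algebraMap R (integralClosure R L) v * (Fintype.card H : integralClosure R L) = 1 := by
    rw [← map_natCast (algebraMap R (integralClosure R L)), ← map_mul, hv, map_one]
  have hfix : ∀ h, ∃ r : R, algebraMap R (integralClosure R L) r =
      idempotentCoeff (algebraMap R (integralClosure R L) v) S h := fun h => by
    obtain ⟨r, hr⟩ := exists_algebraMap_eq_of_fixed (R := R) (K := K)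
      (idempotentCoeff (algebraMap R (integralClosure R L) v) S h).2 (by
      intro τ
      rw [← coe_integralClosureMap (R := R)]
      congr 1
      rw [idempotentCoeff, map_mul, AlgHom.commutes, map_sum]
      congr 1
      refine Finset.sum_bij' (fun ψ _ => act τ ψ) (fun ψ _ => act τ⁻¹ ψ) ?_ ?_ ?_ ?_ ?_
      · intro ψ hψ
        obtain ⟨σ, -, rfl⟩ := Finset.mem_image.mp hψ
        exact Finset.mem_image.mpr ⟨τ * σ, Finset.mem_univ _, rfl⟩
      · intro ψ hψ
        obtain ⟨σ, -, rfl⟩ := Finset.mem_image.mp hψ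
        exact Finset.mem_image.mpr ⟨τ⁻¹ * σ, Finset.mem_univ _, rfl⟩
      · intro ψ _
        ext h
        exact τ.symm_apply_apply _
      · intro ψ _
        ext h
        exact τ.apply_symm_apply _
      · intro ψ _
        rfl)
    exact ⟨r, Subtype.ext hr⟩
  choose r hr using hfix
  have hinj : Function.Injective (algebraMap R (integralClosure R L)) := by
    have : Function.Injective (algebraMap R L) := by
      rw [IsScalarTower.algebraMap_eq R K L]
      exact (algebraMap K L).injective.comp (IsFractionRing.injective R K)
    exact fun x y hxy => this (congrArg Subtype.val hxy)
  refine ⟨r, fun h => hinj ?_, ?_, fun ψ hψ => ?_⟩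
  · simp_rw [map_sum, map_mul, hr]
    exact sum_idempotentCoeff_mul_idempotentCoeff hv' S h
  · simp_rw [hr]
    rw [sum_idempotentCoeff_mul_apply hv', if_pos]
    exact Finset.mem_image.mpr ⟨1, Finset.mem_univ _, rfl⟩
  · simp_rw [hr]
    rw [sum_idempotentCoeff_mul_apply hv', if_neg]
    intro hmem
    obtain ⟨σ, -, rfl⟩ := Finset.mem_image.mp hmem
    exact hψ σ rfl

variable [Finite (ResidueField R)] {n : ℕ} [NeZero n] {G : Type*} [CommGroup G] [Finite G]

/-- A maximal ideal of `R[G]` is the kernel of a homomorphism to the algebraic closure of the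
residue field, which is determined, as `p`-th roots are unique there, by a character of the
`n`-torsion subgroup `H`. If every Galois automorphism acts on `ζ` as a power of Frobenius, then
Galois conjugate characters define the same maximal ideal, and the idempotent of a Galois orbit
separates the remaining pairs. -/
theorem isCleanRing_monoidAlgebra_of_galois {p a : ℕ} [Fact p.Prime] [CharP (ResidueField R) p]
    (hG : Monoid.exponent G = p ^ a * n) (hn : (n : ResidueField R) ≠ 0) {ζ : L}
    (hζ : IsPrimitiveRoot ζ n)
    (hgal : ∀ σ : L ≃ₐ[K] L, ∃ j : ℕ, σ ζ = ζ ^ (Nat.card (ResidueField R) ^ j)) :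
    IsCleanRing (MonoidAlgebra R G) := by
  classical
  have := finite_maximalSpectrum (R := R) (MonoidAlgebra R G)
  let H : Subgroup G := (powMonoidHom n : G →* G).ker
  have := Fintype.ofFinite H
  have hHn : ∀ h : H, h ^ n = 1 := fun h => Subtype.ext h.2
  have hcard : (Fintype.card H : ResidueField R) ≠ 0 := by
    rw [Ne, CharP.cast_eq_zero_iff (ResidueField R) p] at hn ⊢
    intro hdvd
    obtain ⟨x, hx⟩ := exists_prime_orderOf_dvd_card p hdvd
    exact hn (hx ▸ orderOf_dvd_of_pow_eq_one (hHn x))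
  have hint : IsIntegral R ζ := (hζ.isIntegral (NeZero.pos n)).tower_top
  let Z : integralClosure R L := ⟨ζ, hint⟩
  have hZ : IsPrimitiveRoot Z n := IsPrimitiveRoot.of_map_of_injective
    (f := (integralClosure R L).val) hζ Subtype.val_injective
  obtain ⟨Q, hQ⟩ := Ideal.exists_maximal (integralClosure R L)
  obtain ⟨β, -⟩ := exists_algHom_ker_eq (R := R) Q
  have hnΩ := natCast_algebraicClosure_ne_zero hn
  have hβZ := hZ.map_of_natCast_ne_zero (β : integralClosure R L →+* _) hnΩ
  -- every algebra map to the algebraic closure comes from a character on `H`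
  have hchar : ∀ θ : MonoidAlgebra R G →ₐ[R] AlgebraicClosure (ResidueField R),
      ∃ χ : H →* integralClosure R L, (∀ h, β (χ h) = θ (MonoidAlgebra.of R G h)) ∧
        ∀ h, χ h ^ n = 1 := fun θ => by
    have : ∀ h : H, ∃ y : integralClosure R L, y ^ n = 1 ∧ β y = θ (MonoidAlgebra.of R G h) := by
      intro h
      obtain ⟨i, -, hi⟩ := hβZ.eq_pow_of_pow_eq_one
        (ξ := θ (MonoidAlgebra.of R G h)) (by
          rw [← map_pow, ← map_pow, ← Subgroup.coe_pow, hHn, Subgroup.coe_one, map_one, map_one])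
      exact ⟨Z ^ i, by rw [← pow_mul, mul_comm, pow_mul, hZ.pow_eq_one, one_pow],
        by rw [map_pow]; exact hi⟩
    choose χ hχ1 hχ2 using this
    have hext : ∀ {x y : integralClosure R L}, x ^ n = 1 → y ^ n = 1 → β x = β y → x = y :=
      fun hx hy hxy => eq_of_pow_eq_one_of_map_eq (β : integralClosure R L →+* _) hnΩ hx hy hxy
    exact ⟨⟨⟨χ, hext (hχ1 1) (one_pow _)
      (by rw [hχ2, Subgroup.coe_one, map_one, map_one, map_one])⟩, fun g h =>
        hext (hχ1 _) (by rw [mul_pow, hχ1, hχ1, one_mul])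
          (by rw [map_mul, hχ2, hχ2, hχ2, ← map_mul, ← map_mul, Subgroup.coe_mul])⟩, hχ2, hχ1⟩
  refine isCleanRing_of_separated fun N M hNM => ?_
  obtain ⟨θM, hθM⟩ := exists_algHom_ker_eq (R := R) M.asIdeal
  obtain ⟨θN, hθN⟩ := exists_algHom_ker_eq (R := R) N.asIdeal
  obtain ⟨χ, hχ, hχn⟩ := hchar θM
  obtain ⟨ψ, hψ, -⟩ := hchar θN
  obtain ⟨r, hr, hr1, hr0⟩ := exists_idempotent_of_orbit (K := K) hcard χ
  let e : MonoidAlgebra R G := ∑ h : H, algebraMap R _ (r h) * MonoidAlgebra.of R G h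
  have heval : ∀ (θ : MonoidAlgebra R G →ₐ[R] AlgebraicClosure (ResidueField R))
      (χ : H →* integralClosure R L), (∀ h, β (χ h) = θ (MonoidAlgebra.of R G h)) →
      θ e = β (∑ h, algebraMap R (integralClosure R L) (r h) * χ h) := fun θ χ hχ => by
    simp only [e, map_sum, map_mul, AlgHom.commutes, hχ]
  have he : IsIdempotentElem e := by
    change e * e = e
    calc e * e = ∑ g : H, ∑ h : H, algebraMap R (MonoidAlgebra R G) (r g * r h) *
          MonoidAlgebra.of R G (g * h : H) := by
          simp only [e]
          rw [Finset.sum_mul_sum]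
          refine Finset.sum_congr rfl fun g _ => Finset.sum_congr rfl fun h _ => ?_
          rw [map_mul, Subgroup.coe_mul, map_mul]; ring
      _ = ∑ g : H, ∑ h : H, algebraMap R (MonoidAlgebra R G) (r g * r (g⁻¹ * h)) *
          MonoidAlgebra.of R G (h : H) := by
          refine Finset.sum_congr rfl fun g _ => ?_
          refine Fintype.sum_equiv (Equiv.mulLeft g) _ _ fun h => ?_
          simp
      _ = e := by
          rw [Finset.sum_comm]
          refine Finset.sum_congr rfl fun h _ => ?_
          rw [← Finset.sum_mul, ← map_sum, hr]
  refine ⟨e, he, ?_, ?_⟩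
  · rw [← hθN, RingHom.mem_ker]
    refine (heval θN ψ hψ).trans ?_
    rw [hr0 ψ, map_zero]
    rintro σ rfl
    -- if the characters are conjugate, then so are the algebra maps, by a power of Frobenius
    obtain ⟨j, hj⟩ := hgal σ
    apply hNM
    ext1
    rw [← hθN, ← hθM]
    have hσ : ∀ x : integralClosure R L, x ^ n = 1 →
        integralClosureMap (R := R) σ x = x ^ (Nat.card (ResidueField R) ^ j) := fun x hx => by
      obtain ⟨i, -, rfl⟩ := hZ.eq_pow_of_pow_eq_one hx
      rw [map_pow, ← pow_mul, mul_comm, pow_mul]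
      congr 1
      exact Subtype.ext hj
    have hH : ∀ h : H, θN (MonoidAlgebra.of R G h) =
        (residueFrobenius R ^ j) (θM (MonoidAlgebra.of R G h)) := fun h => by
      rw [residueFrobenius_pow_apply, ← hψ, ← hχ, ← map_pow, ← hσ _ (hχn h)]
      rfl
    -- `p`-power roots are unique, so agreement on `H` gives agreement on `G`
    have hθ : θN = (residueFrobenius R ^ j).comp θM := by
      refine MonoidAlgebra.algHom_ext (fun g => ?_) (Subsingleton.elim _ _)
      have : CharP (AlgebraicClosure (ResidueField R)) p :=
        charP_of_injective_algebraMap (algebraMap (ResidueField R) _).injective p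
      apply iterateFrobenius_inj (AlgebraicClosure (ResidueField R)) p a
      have hg : g ^ p ^ a ∈ H := by
        simp only [H, MonoidHom.mem_ker, powMonoidHom_apply]
        rw [← pow_mul, ← hG, Monoid.pow_exponent_eq_one]
      have h1 := hH ⟨_, hg⟩
      rw [map_pow, map_pow, map_pow, map_pow] at h1
      rw [iterateFrobenius_def, iterateFrobenius_def]
      exact h1
    rw [hθ]
    ext x
    simp only [RingHom.mem_ker, AlgHom.comp_apply]
    rw [residueFrobenius_pow_apply, pow_eq_zero_iff (pow_ne_zero _ Nat.card_pos.ne')]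
  · rw [← hθM, RingHom.mem_ker, map_sub, map_one, sub_eq_zero]
    exact ((heval θM χ hχ).trans (by rw [hr1, map_one])).symm

end Clean

end

/-! ### Cleanness of group rings over local rings and orders of residue field sizes -/

section
open IsLocalRing Polynomial

section Criterion
variable {R K : Type*} (L : Type*) [CommRing R] [Field K] [Algebra R K]
  [Field L] [Algebra K L]
  [IsLocalRing R] [IsIntegrallyClosed R] [IsFractionRing R K]
  [Finite (ResidueField R)] {n : ℕ} [NeZero n] [IsCyclotomicExtension {n} K L]
  {G : Type*} [CommGroup G] [Finite G]

/-- The group ring is clean if and only if the size `q` of the residue field, seen in `(ℤ/n)ˣ`,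
generates the Galois group of the `n`-th cyclotomic extension of `K`, that is, if and only if the
order of `q` modulo `n` is the degree of this extension. -/
theorem isCleanRing_monoidAlgebra_iff_orderOf {p a : ℕ} [CharZero K]
    [Fact p.Prime] [CharP (ResidueField R) p]
    (hG : Monoid.exponent G = p ^ a * n) (hn : ¬ p ∣ n) :
    IsCleanRing (MonoidAlgebra R G) ↔
      orderOf (Nat.card (ResidueField R) : ZMod n) = Module.finrank K L := by
  classical
  let _ : Algebra R L := ((algebraMap K L).comp (algebraMap R K)).toAlgebra
  have : IsScalarTower R K L := .of_algebraMap_eq fun _ => rfl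
  have : FiniteDimensional K L := IsCyclotomicExtension.finiteDimensional {n} K L
  have : IsGalois K L := IsCyclotomicExtension.isGalois {n} K L
  have hζ := IsCyclotomicExtension.zeta_spec n K L
  set ζ := IsCyclotomicExtension.zeta n K L
  have hnk : (n : ResidueField R) ≠ 0 := by rwa [Ne, CharP.cast_eq_zero_iff (ResidueField R) p]
  have h1 : IsCleanRing (MonoidAlgebra R G) ↔
      ∀ σ : L ≃ₐ[K] L, ∃ j : ℕ, σ ζ = ζ ^ (Nat.card (ResidueField R) ^ j) :=
    ⟨fun h => galois_apply_eq_pow_of_isCleanRing hG hnk hζ h,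
      isCleanRing_monoidAlgebra_of_galois hG hnk hζ⟩
  rw [h1]
  set q := Nat.card (ResidueField R)
  obtain ⟨φ, hφ⟩ := exists_algEquiv_apply_eq_pow_card (R := R) (K := K) hnk hζ
  have hpow : ∀ (σ : L ≃ₐ[K] L) (j : ℕ), σ ζ = ζ ^ j ↔ (hζ.autToPow K σ : ZMod n) = j := by
    intro σ j
    have key : ∀ i : ℕ, ζ ^ i = ζ ^ j ↔ (i : ZMod n) = j := fun i => by
      obtain ⟨u, hu⟩ := hζ.isUnit (NeZero.ne n)
      rw [← hu, ← Units.val_pow_eq_pow_val, ← Units.val_pow_eq_pow_val,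
        Units.val_inj, pow_eq_pow_iff_modEq, ← orderOf_units, hu, ← hζ.eq_orderOf,
        ← ZMod.natCast_eq_natCast_iff]
    rw [← hζ.autToPow_spec K σ, key, ZMod.natCast_zmod_val]
  have hφq := (hpow φ q).mp hφ
  have hinj := hζ.autToPow_injective K
  rw [← hφq, orderOf_units, orderOf_injective _ hinj, ← IsGalois.card_aut_eq_finrank]
  have h2 : (∀ σ : L ≃ₐ[K] L, ∃ j : ℕ, σ ζ = ζ ^ (q ^ j)) ↔ ∀ σ, σ ∈ Subgroup.zpowers φ := by
    refine forall_congr' fun σ => ?_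
    rw [← mem_powers_iff_mem_zpowers]
    refine exists_congr fun j => ?_
    rw [hpow, Nat.cast_pow, ← hφq, ← Units.val_pow_eq_pow_val, Units.val_inj, ← map_pow,
      hinj.eq_iff, eq_comm]
  rw [h2, ← Subgroup.eq_top_iff', ← Nat.card_zpowers]
  constructor
  · intro h
    rw [h, Subgroup.card_top]
  · exact Subgroup.eq_top_of_card_eq _
end Criterion

end

/-! ### The degree of cyclotomic extensions of quadratic fields and Gauss sums -/

section
open Polynomial

section Quadratic

theorem not_isSquare_of_squarefree {d : ℤ} (hd : Squarefree d) (hd1 : d ≠ 1) (x : ℚ) :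
    x ^ 2 ≠ (d : ℚ) := by
  intro hx
  have h1 : IsSquare (d : ℚ) := ⟨x, by rw [← hx, sq]⟩
  obtain ⟨y, rfl⟩ := Rat.isSquare_intCast_iff.mp h1
  have := hd y dvd_rfl
  rcases Int.isUnit_iff.mp this with rfl | rfl <;> simp at hd1

variable {d : ℤ} (hd : Squarefree d) (hd1 : d ≠ 1) {K L : Type*} [Field K] [CharZero K]
  {δ : K} (hδ : δ ^ 2 = (d : K)) (hK : IntermediateField.adjoin ℚ {δ} = ⊤)
  [Field L] [Algebra K L] [CharZero L]

include hd hd1 hδ in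
theorem minpoly_sqrt_eq : minpoly ℚ δ = X ^ 2 - C (d : ℚ) := by
  refine (minpoly.eq_of_irreducible_of_monic ?_ (by simp [hδ])
    (monic_X_pow_sub_C _ two_ne_zero)).symm
  rw [X_pow_sub_C_irreducible_iff_of_prime Nat.prime_two]
  exact not_isSquare_of_squarefree hd hd1

include hd hd1 hδ hK in
theorem finrank_eq_two : Module.finrank ℚ K = 2 := by
  have hint : IsIntegral ℚ δ := ⟨X ^ 2 - C (d : ℚ), monic_X_pow_sub_C _ two_ne_zero, by
    rw [eval₂_sub, eval₂_X_pow, eval₂_C, hδ, map_intCast, sub_self]⟩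
  rw [← IntermediateField.finrank_top', ← hK, IntermediateField.adjoin.finrank hint,
    minpoly_sqrt_eq hd hd1 hδ, natDegree_X_pow_sub_C]

variable {n : ℕ} [NeZero n] [IsCyclotomicExtension {n} K L] {ζ : L} (hζ : IsPrimitiveRoot ζ n)

include hd hd1 hδ hK hζ in
/-- The degree of the `n`-th cyclotomic extension of a quadratic field `ℚ(δ)`, `δ² = d`, depends on
whether `δ` lies in the `n`-th cyclotomic field over `ℚ`. -/
theorem finrank_cyclotomic_quadratic :
    (algebraMap K L δ ∈ IntermediateField.adjoin ℚ {ζ} → 2 * Module.finrank K L = n.totient) ∧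
    (algebraMap K L δ ∉ IntermediateField.adjoin ℚ {ζ} → Module.finrank K L = n.totient) := by
  set F := IntermediateField.adjoin ℚ {ζ} with hF
  set ε := algebraMap K L δ with hε
  have hεd : ε ^ 2 = (d : L) := by rw [hε, ← map_pow, hδ, map_intCast]
  have : IsScalarTower ℚ K L := inferInstance
  have h2 := finrank_eq_two hd hd1 hδ hK
  have : FiniteDimensional ℚ K := Module.finite_of_finrank_pos (by lia)
  have : FiniteDimensional K L := IsCyclotomicExtension.finiteDimensional {n} K L
  have : FiniteDimensional ℚ L := FiniteDimensional.trans ℚ K L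
  have hcyc : IsCyclotomicExtension {n} ℚ F :=
    hζ.intermediateField_adjoin_isCyclotomicExtension ℚ
  have hFn : Module.finrank ℚ F = n.totient :=
    IsCyclotomicExtension.finrank F (cyclotomic.irreducible_rat (NeZero.pos n))
  have hKL := Module.finrank_mul_finrank ℚ K L
  have hFL := Module.finrank_mul_finrank ℚ F L
  rw [h2] at hKL
  rw [hFn] at hFL
  have htop : IntermediateField.adjoin F {ε} = ⊤ := by
    rw [eq_top_iff]
    intro x _
    have hx : x ∈ Algebra.adjoin K {b : L | ∃ m ∈ ({n} : Set ℕ), m ≠ 0 ∧ b ^ m = 1} := by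
      rw [((IsCyclotomicExtension.iff_adjoin_eq_top {n} K L).mp inferInstance).2]
      trivial
    induction hx using Algebra.adjoin_induction with
    | mem y hy =>
      obtain ⟨m, rfl, -, hy⟩ := hy
      obtain ⟨i, -, rfl⟩ := hζ.eq_pow_of_pow_eq_one hy
      exact pow_mem ((IntermediateField.adjoin F {ε}).algebraMap_mem
        ⟨ζ, IntermediateField.mem_adjoin_simple_self ℚ ζ⟩) _
    | algebraMap y =>
      have hy : y ∈ IntermediateField.adjoin ℚ {δ} := by rw [hK]; trivial
      let T : IntermediateField ℚ K :=
        ((IntermediateField.adjoin F {ε}).restrictScalars ℚ).comap (IsScalarTower.toAlgHom ℚ K L)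
      have : IntermediateField.adjoin ℚ {δ} ≤ T := by
        rw [IntermediateField.adjoin_simple_le_iff]
        exact IntermediateField.mem_adjoin_simple_self F ε
      exact this hy
    | add x y _ _ hx hy => exact add_mem (hx trivial) (hy trivial)
    | mul x y _ _ hx hy => exact mul_mem (hx trivial) (hy trivial)
  have hint : IsIntegral F ε := Algebra.IsIntegral.isIntegral ε
  have hdeg : Module.finrank F L = (minpoly F ε).natDegree := by
    rw [← IntermediateField.finrank_top', ← htop, IntermediateField.adjoin.finrank hint]
  constructor
  · intro hmem
    have : Module.finrank F L = 1 := by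
      rw [hdeg]
      exact minpoly.natDegree_eq_one_iff.mpr ⟨⟨ε, hmem⟩, rfl⟩
    rw [this, mul_one] at hFL
    rw [hKL, hFL]
  · intro hmem
    have : minpoly F ε = X ^ 2 - C (d : F) := by
      refine (minpoly.eq_of_irreducible_of_monic ?_ (by simp [hεd])
        (monic_X_pow_sub_C _ two_ne_zero)).symm
      rw [X_pow_sub_C_irreducible_iff_of_prime Nat.prime_two]
      intro b hb
      have hb' : ε ^ 2 = (b : L) ^ 2 := by
        rw [hεd]; simpa using (congrArg Subtype.val hb).symm
      rcases sq_eq_sq_iff_eq_or_eq_neg.mp hb' with h | h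
      · exact hmem (h ▸ b.2)
      · exact hmem (h ▸ neg_mem b.2)
    rw [hdeg, this, natDegree_X_pow_sub_C] at hFL
    lia
end Quadratic

section GaussSum
variable {L : Type*} [Field L] [CharZero L] {n : ℕ} [NeZero n] {ζ : L} (hζ : IsPrimitiveRoot ζ n)
  (F : Subfield L) (hF : ζ ∈ F)
include hζ hF

/-- The quadratic Gauss sum: a cyclotomic field contains a square root of `(-1)^((q-1)/2) q`. -/
theorem exists_sq_eq_chi_four_mul_prime {q : ℕ} (hq : q.Prime) (hq2 : q ≠ 2) (hqn : q ∣ n) :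
    ∃ x ∈ F, x ^ 2 = ((ZMod.χ₄ q * q : ℤ) : L) := by
  have : Fact q.Prime := ⟨hq⟩
  obtain ⟨m, rfl⟩ := hqn
  have hζq : IsPrimitiveRoot (ζ ^ m) q := hζ.pow (NeZero.pos _) (mul_comm _ _)
  let χ : MulChar (ZMod q) L := (quadraticChar (ZMod q)).ringHomComp (Int.castRingHom L)
  let ψ : AddChar (ZMod q) L := AddChar.zmodChar q hζq.pow_eq_one
  have hchar : ringChar (ZMod q) ≠ 2 := by rwa [ZMod.ringChar_zmod_n]
  have hχ : χ ≠ 1 :=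
    (MulChar.ringHomComp_ne_one_iff Int.cast_injective).mpr (quadraticChar_ne_one hchar)
  have hχ2 : χ.IsQuadratic := (quadraticChar_isQuadratic (ZMod q)).comp _
  refine ⟨gaussSum χ ψ, ?_, ?_⟩
  · refine sum_mem fun x _ => mul_mem ?_ ?_
    · exact intCast_mem F _
    · rw [AddChar.zmodChar_apply]
      exact pow_mem (pow_mem hF _) _
  · rw [gaussSum_sq hχ hχ2 (AddChar.zmodChar_primitive_of_primitive_root q hζq), ZMod.card]
    simp [χ, quadraticChar_neg_one hchar, ZMod.card]

theorem exists_sq_eq_chi_four_mul {m : ℕ} (hm : Odd m) (hmn : m ∣ n) :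
    ∃ x ∈ F, x ^ 2 = ((ZMod.χ₄ m * m : ℤ) : L) := by
  induction m using Nat.recOnMul with
  | zero => simp at hm
  | one => exact ⟨1, one_mem F, by simp⟩
  | prime q hq =>
    exact exists_sq_eq_chi_four_mul_prime hζ F hF hq
      (by rintro rfl; exact absurd hm (by decide)) hmn
  | mul a b ha hb =>
    obtain ⟨x, hx, hx2⟩ := ha (Nat.odd_mul.mp hm).1 (dvd_of_mul_right_dvd hmn)
    obtain ⟨y, hy, hy2⟩ := hb (Nat.odd_mul.mp hm).2 (dvd_of_mul_left_dvd hmn)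
    exact ⟨x * y, mul_mem hx hy, by
      rw [mul_pow, hx2, hy2]; push_cast; rw [map_mul]; push_cast; ring⟩

theorem exists_sq_eq_of_modFour_eq_one {d : ℤ} (hd : d % 4 = 1) (hdn : d ∣ n) :
    ∃ x ∈ F, x ^ 2 = (d : L) := by
  have hodd : Odd d.natAbs := by rw [Int.natAbs_odd, Int.odd_iff]; lia
  obtain ⟨x, hx, hx2⟩ := exists_sq_eq_chi_four_mul hζ F hF hodd (Int.natAbs_dvd_natAbs.mpr hdn)
  refine ⟨x, hx, ?_⟩
  rw [hx2]
  congr 1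
  rw [ZMod.χ₄_nat_eq_if_mod_four]
  split_ifs <;> lia

omit [CharZero L] in
theorem exists_sq_eq_neg_one (h4 : 4 ∣ n) : ∃ x ∈ F, x ^ 2 = (-1 : L) := by
  obtain ⟨m, rfl⟩ := h4
  have h : IsPrimitiveRoot (ζ ^ m) 4 := hζ.pow (NeZero.pos _) (mul_comm _ _)
  have h2 : IsPrimitiveRoot ((ζ ^ m) ^ 2) 2 := h.pow (by norm_num) (by norm_num)
  exact ⟨ζ ^ m, pow_mem hF _, h2.eq_neg_one_of_two_right⟩

omit [CharZero L] in
theorem exists_sq_eq_two (h8 : 8 ∣ n) : ∃ x ∈ F, x ^ 2 = (2 : L) := by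
  obtain ⟨m, rfl⟩ := h8
  have h : IsPrimitiveRoot (ζ ^ m) 8 := hζ.pow (NeZero.pos _) (mul_comm _ _)
  set η := ζ ^ m with hη
  have h2 : IsPrimitiveRoot (η ^ 4) 2 := h.pow (by norm_num) (by norm_num)
  have h4 := h2.eq_neg_one_of_two_right
  -- `η³ = -η⁻¹`, so this is `η + η⁻¹`
  refine ⟨η - η ^ 3, sub_mem (pow_mem hF _) (pow_mem (pow_mem hF _) _), ?_⟩
  linear_combination (η ^ 2 - 2) * h4

/-- A quadratic field whose discriminant divides `n` lies in the `n`-th cyclotomic field. -/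
theorem exists_sq_eq_of_discr_dvd {d : ℤ} (hd : Squarefree d)
    (hdn : (if d % 4 = 1 then d else 4 * d) ∣ (n : ℤ)) : ∃ x ∈ F, x ^ 2 = (d : L) := by
  split_ifs at hdn with h1
  · exact exists_sq_eq_of_modFour_eq_one hζ F hF h1 hdn
  have h4 : 4 ∣ n := by exact_mod_cast dvd_of_mul_right_dvd hdn
  have hd' : d ∣ n := dvd_of_mul_left_dvd hdn
  obtain ⟨i, hi, hi2⟩ := exists_sq_eq_neg_one hζ F hF h4
  have hneg : ∀ {e : ℤ}, e % 2 = 1 → e ∣ n → ∃ x ∈ F, x ^ 2 = (e : L) := by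
    intro e he hen
    rcases (by lia : e % 4 = 1 ∨ (-e) % 4 = 1) with h | h
    · exact exists_sq_eq_of_modFour_eq_one hζ F hF h hen
    · obtain ⟨x, hx, hx2⟩ := exists_sq_eq_of_modFour_eq_one hζ F hF h (neg_dvd.mpr hen)
      exact ⟨i * x, mul_mem hi hx, by rw [mul_pow, hi2, hx2]; push_cast; ring⟩
  rcases Int.emod_two_eq_zero_or_one d with h | h
  · obtain ⟨e, rfl⟩ := Int.dvd_of_emod_eq_zero h
    have he : e % 2 = 1 := by
      by_contra he
      have := hd 2 (mul_dvd_mul_left 2 (Int.dvd_of_emod_eq_zero (by lia)))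
      rw [Int.isUnit_iff] at this
      lia
    have h8 : 8 ∣ n := by
      have : (8 : ℤ) ∣ n := dvd_trans ⟨e, by ring⟩ hdn
      exact_mod_cast this
    obtain ⟨x, hx, hx2⟩ := hneg he (dvd_of_mul_left_dvd hd')
    obtain ⟨y, hy, hy2⟩ := exists_sq_eq_two hζ F hF h8
    exact ⟨y * x, mul_mem hy hx, by rw [mul_pow, hy2, hx2]; push_cast; ring⟩
  · exact hneg h hd'
end GaussSum

end

/-! ### The conductor of a quadratic field -/

section
open Polynomial NumberTheorySymbols

section Residues

/-- Quadratic reciprocity for a discriminant `e ≡ 1 (mod 4)` of either sign. -/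
theorem jacobiSym_eq_of_modFour_eq_one {e : ℤ} (he : e % 4 = 1) {b : ℕ} (hb : Odd b) :
    jacobiSym e b = jacobiSym b e.natAbs := by
  rcases le_or_gt 0 e with h | h
  · obtain ⟨m, rfl⟩ := Int.eq_ofNat_of_zero_le h
    rw [Int.natAbs_natCast]
    exact jacobiSym.quadratic_reciprocity_one_mod_four (by lia) hb
  · obtain ⟨m, hm⟩ := Int.eq_ofNat_of_zero_le (a := -e) (by lia)
    obtain rfl : e = -m := by lia
    rw [Int.natAbs_neg, Int.natAbs_natCast, jacobiSym.neg _ hb]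
    have hm3 : m % 4 = 3 := by lia
    rcases Nat.odd_mod_four_iff.mp (Nat.odd_iff.mp hb) with h1 | h3
    · rw [ZMod.χ₄_nat_one_mod_four h1, one_mul]
      exact jacobiSym.quadratic_reciprocity_one_mod_four' (Nat.odd_iff.mpr (by lia)) h1
    · rw [ZMod.χ₄_nat_three_mod_four h3, jacobiSym.quadratic_reciprocity_three_mod_four hm3 h3]
      ring

theorem jacobiSym_eq_one_of_modEq_one {a m n : ℕ} (ha : a ≡ 1 [MOD n]) (hm : m ∣ n) :
    jacobiSym a m = 1 := by
  rw [jacobiSym.mod_left' (a₂ := 1), jacobiSym.one_left]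
  have := ha.of_dvd hm
  unfold Nat.ModEq at this
  exact_mod_cast this

theorem dvd_of_squarefree_of_forall_prime {m n : ℕ} (hm : Squarefree m)
    (h : ∀ q, q.Prime → q ∣ m → q ∣ n) : m ∣ n := by
  rw [← Nat.prod_primeFactors_of_squarefree hm]
  refine Finset.prod_primes_dvd n (fun q hq => (Nat.prime_of_mem_primeFactors hq).prime)
    fun q hq => h q (Nat.prime_of_mem_primeFactors hq) (Nat.dvd_of_mem_primeFactors hq)

variable {d : ℤ} (hd : Squarefree d) {n : ℕ} [NeZero n]
include hd

omit [NeZero n] in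
/-- The residue class is chosen as a nonresidue modulo `q`, and as `1` modulo `n`, `8` and the
other factors of `d`. -/
theorem exists_jacobiSym_eq_neg_one_of_prime_not_dvd {q : ℕ} (hq : q.Prime) (hq2 : q ≠ 2)
    (hqd : (q : ℤ) ∣ d) (hqn : ¬ q ∣ n) :
    ∃ a : ℕ, Odd a ∧ a ≡ 1 [MOD n] ∧ jacobiSym d a = -1 := by
  have : Fact q.Prime := ⟨hq⟩
  obtain ⟨e, rfl⟩ := hqd
  have hqe : ¬ q ∣ e.natAbs := fun h => by
    have := hd q (mul_dvd_mul_left _ (Int.natCast_dvd.mpr h))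
    rw [Int.ofNat_isUnit, Nat.isUnit_iff] at this
    exact hq.one_lt.ne' this
  have he : e.natAbs ≠ 0 := by
    rw [Int.natAbs_ne_zero]; rintro rfl; simp at hqe
  have hcop : (8 * n * e.natAbs).Coprime q := by
    refine ((hq.coprime_iff_not_dvd).mpr fun h => ?_).symm
    rcases (hq.dvd_mul.mp h) with h | h
    · rcases (hq.dvd_mul.mp h) with h | h
      · exact hq2 ((Nat.prime_dvd_prime_iff_eq hq Nat.prime_two).mp
          (hq.dvd_of_dvd_pow (show q ∣ 2 ^ 3 from h)))
      · exact hqn h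
    · exact hqe h
  obtain ⟨r, hr⟩ := quadraticChar_exists_neg_one (F := ZMod q) (by rwa [ZMod.ringChar_zmod_n])
  obtain ⟨a, ha1, har⟩ := Nat.chineseRemainder hcop 1 r.val
  have ha8 : a % 8 = 1 := ha1.of_dvd ⟨n * e.natAbs, by ring⟩
  have hodd : Odd a := Nat.odd_iff.mpr (by lia)
  refine ⟨a, hodd, ha1.of_dvd ⟨8 * e.natAbs, by ring⟩, ?_⟩
  have h1 : jacobiSym e a = 1 := by
    rw [jacobiSym.mod_right e hodd]
    have : a % (4 * e.natAbs) = 1 % (4 * e.natAbs) := ha1.of_dvd ⟨2 * n, by ring⟩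
    rw [this, Nat.mod_eq_of_lt (by lia), jacobiSym.one_right]
  rw [jacobiSym.mul_left, h1, mul_one, jacobiSym.quadratic_reciprocity_one_mod_four'
    (hq.odd_of_ne_two hq2) (by lia), ← jacobiSym.legendreSym.to_jacobiSym, legendreSym]
  have : (a : ZMod q) = r := by
    rw [(ZMod.natCast_eq_natCast_iff _ _ _).mpr har, ZMod.natCast_zmod_val]
  rw [Int.cast_natCast, this, hr]

/-- If the discriminant of `ℚ(√d)` does not divide `n`, then some odd residue class that is trivial
modulo `n` has Jacobi symbol `-1`. An odd prime dividing `d` but not `n` leaves the class modulo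
this prime free; otherwise `n` is not divisible enough by `2`, and the class is varied modulo `8`
or `4`. -/
theorem exists_jacobiSym_eq_neg_one (hdn : ¬ (if d % 4 = 1 then d else 4 * d) ∣ (n : ℤ)) :
    ∃ a : ℕ, Odd a ∧ a ≡ 1 [MOD n] ∧ jacobiSym d a = -1 := by
  by_cases hex : ∃ q : ℕ, q.Prime ∧ q ≠ 2 ∧ (q : ℤ) ∣ d ∧ ¬ q ∣ n
  · obtain ⟨q, hq, hq2, hqd, hqn⟩ := hex
    exact exists_jacobiSym_eq_neg_one_of_prime_not_dvd hd hq hq2 hqd hqn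
  push Not at hex
  obtain ⟨k, m, hm, hn⟩ := Nat.exists_eq_two_pow_mul_odd (NeZero.ne n)
  -- an odd divisor of `d` divides the odd part of `n`
  have hodd : ∀ e : ℤ, Odd e → e ∣ d → e.natAbs ∣ m := fun e he hed => by
    refine Nat.Coprime.dvd_of_dvd_mul_left
      ((Nat.coprime_two_right.mpr (Int.natAbs_odd.mpr he)).pow_right k) ?_
    rw [← hn]
    refine dvd_of_squarefree_of_forall_prime (Int.squarefree_natAbs.mpr (hd.squarefree_of_dvd hed))
      fun q hq hqe => ?_
    refine hex q hq ?_ ((Int.natCast_dvd.mpr hqe).trans hed)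
    rintro rfl
    exact absurd (Int.natAbs_odd.mpr he) (Nat.not_odd_iff_even.mpr (even_iff_two_dvd.mpr hqe))
  rcases (by lia : d % 4 = 0 ∨ d % 4 = 1 ∨ d % 4 = 2 ∨ d % 4 = 3) with h | h | h | h
  · exfalso
    have := hd 2 (Int.dvd_of_emod_eq_zero h)
    rw [Int.isUnit_iff] at this
    lia
  · rw [if_pos h] at hdn
    exfalso
    apply hdn
    rw [← Int.natAbs_dvd_natAbs, Int.natAbs_natCast, hn]
    exact (hodd d (Int.odd_iff.mpr (by lia)) dvd_rfl).mul_left _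
  · rw [if_neg (by lia)] at hdn
    obtain ⟨e, rfl⟩ := Int.dvd_of_emod_eq_zero (by lia : d % 2 = 0)
    have he : Odd e := Int.odd_iff.mpr (by lia)
    have hem := hodd e he (dvd_mul_left _ _)
    have hk : k ≤ 2 := by
      by_contra hk
      apply hdn
      rw [← mul_assoc, hn]
      push_cast
      exact mul_dvd_mul (by simpa using (pow_dvd_pow (2 : ℤ) (by lia : 3 ≤ k)))
        (Int.dvd_natCast.mpr hem)
    have hcop : m.Coprime 8 := (Nat.coprime_two_right.mpr hm).pow_right 3
    obtain ⟨a, ha1, ha5⟩ := Nat.chineseRemainder hcop 1 5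
    have ha5 : a % 8 = 5 := ha5
    have ha : Odd a := Nat.odd_iff.mpr (by lia)
    refine ⟨a, ha, ?_, ?_⟩
    · have h4 : a ≡ 1 [MOD 2 ^ k] :=
        (show a ≡ 1 [MOD 2 ^ 2] by unfold Nat.ModEq; lia).of_dvd (pow_dvd_pow 2 hk)
      rw [hn]
      exact (Nat.modEq_and_modEq_iff_modEq_mul ((Nat.coprime_two_left.mpr hm).pow_left k)).mp
        ⟨h4, ha1⟩
    · have h1 : jacobiSym e a = 1 := by
        rcases (by have := Int.odd_iff.mp he; lia : e % 4 = 1 ∨ (-e) % 4 = 1) with h | h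
        · rw [jacobiSym_eq_of_modFour_eq_one h ha]
          exact jacobiSym_eq_one_of_modEq_one ha1 hem
        · rw [← neg_neg e, jacobiSym.neg _ ha, jacobiSym_eq_of_modFour_eq_one h ha,
            Int.natAbs_neg, jacobiSym_eq_one_of_modEq_one ha1 hem,
            ZMod.χ₄_nat_one_mod_four (by lia), mul_one]
      rw [jacobiSym.mul_left, h1, mul_one, jacobiSym.at_two ha, ZMod.χ₈_nat_eq_if_mod_eight]
      simp [ha5, show a % 2 = 1 by lia]
  · rw [if_neg (by lia)] at hdn
    have hem := hodd d (Int.odd_iff.mpr (by lia)) dvd_rfl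
    have hk : k ≤ 1 := by
      by_contra hk
      apply hdn
      rw [hn]
      push_cast
      exact mul_dvd_mul (by simpa using (pow_dvd_pow (2 : ℤ) (by lia : 2 ≤ k)))
        (Int.dvd_natCast.mpr hem)
    have hcop : m.Coprime 4 := (Nat.coprime_two_right.mpr hm).pow_right 2
    obtain ⟨a, ha1, ha3⟩ := Nat.chineseRemainder hcop 1 3
    have ha3 : a % 4 = 3 := ha3
    have ha : Odd a := Nat.odd_iff.mpr (by lia)
    refine ⟨a, ha, ?_, ?_⟩
    · have h4 : a ≡ 1 [MOD 2 ^ k] :=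
        (show a ≡ 1 [MOD 2 ^ 1] by unfold Nat.ModEq; lia).of_dvd (pow_dvd_pow 2 hk)
      rw [hn]
      exact (Nat.modEq_and_modEq_iff_modEq_mul ((Nat.coprime_two_left.mpr hm).pow_left k)).mp
        ⟨h4, ha1⟩
    · rw [← neg_neg d, jacobiSym.neg _ ha, jacobiSym_eq_of_modFour_eq_one (by lia) ha,
        Int.natAbs_neg, jacobiSym_eq_one_of_modEq_one ha1 hem,
        ZMod.χ₄_nat_three_mod_four ha3, mul_one]

/-- Dirichlet's theorem turns the residue class into arbitrarily large primes. -/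
theorem exists_prime_jacobiSym_eq_neg_one
    (hdn : ¬ (if d % 4 = 1 then d else 4 * d) ∣ (n : ℤ)) (N : ℕ) :
    ∃ l > N, l.Prime ∧ l ≡ 1 [MOD n] ∧ jacobiSym d l = -1 := by
  obtain ⟨a, ha, han, hda⟩ := exists_jacobiSym_eq_neg_one hd hdn
  have hd0 : d.natAbs ≠ 0 := Int.natAbs_ne_zero.mpr hd.ne_zero
  have hcop1 : a.Coprime d.natAbs := by
    by_contra h
    have h0 : a ≠ 0 := by rintro rfl; simp at ha
    have : NeZero a := ⟨h0⟩
    rw [jacobiSym.eq_zero_iff_not_coprime.mpr] at hda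
    · simp at hda
    · rwa [Int.gcd_comm, Int.gcd_eq_natAbs, Int.natAbs_natCast]
  have hcop2 : a.Coprime n := by
    rw [Nat.Coprime, han.gcd_eq, Nat.gcd_one_left]
  have hcop : a.Coprime (n * (4 * d.natAbs)) :=
    hcop2.mul_right (((Nat.coprime_two_right.mpr ha).pow_right 2).mul_right hcop1)
  obtain ⟨l, hlN, hl, hla⟩ := Nat.forall_exists_prime_gt_and_modEq N
    (mul_ne_zero (NeZero.ne n) (by lia)) hcop
  have hla4 : l ≡ a [MOD 4] := hla.of_dvd ⟨n * d.natAbs, by ring⟩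
  have hlodd : Odd l := by
    rw [Nat.odd_iff] at ha ⊢
    unfold Nat.ModEq at hla4; lia
  refine ⟨l, hlN, hl, (hla.of_dvd (dvd_mul_right _ _)).trans han, ?_⟩
  rw [jacobiSym.mod_right d hlodd, show l % (4 * d.natAbs) = a % (4 * d.natAbs) from
    hla.of_dvd (dvd_mul_left _ _), ← jacobiSym.mod_right d ha, hda]
end Residues

section Conductor
variable {L : Type*} [Field L] [CharZero L] {n : ℕ} [NeZero n] {ζ : L} (hζ : IsPrimitiveRoot ζ n)
  {d : ℤ} {ε : L} (hε : ε ^ 2 = (d : L)) (hmem : ε ∈ IntermediateField.adjoin ℚ {ζ})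
include hζ hε hmem

/-- If `√d` lies in the `n`-th cyclotomic field, then `d` is a square modulo almost all primes
`l ≡ 1 (mod n)`: write `√d` as a polynomial in `ζ` and reduce the resulting polynomial congruence
modulo the cyclotomic polynomial, which has a root modulo `l`. -/
theorem exists_forall_prime_isSquare : ∃ N : ℕ, ∀ l > N, ∀ _ : Fact l.Prime, l ≡ 1 [MOD n] →
    IsSquare (d : ZMod l) := by
  have hint : IsIntegral ℚ ζ := (hζ.isIntegral (NeZero.pos n)).tower_top
  have h1 : ε ∈ Algebra.adjoin ℚ {ζ} := by
    rw [← IntermediateField.adjoin_simple_toSubalgebra_of_isAlgebraic hint.isAlgebraic]; exact hmem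
  rw [Algebra.adjoin_singleton_eq_range_aeval] at h1
  obtain ⟨P, hP⟩ := h1
  obtain ⟨b, hb, hbP⟩ := IsLocalization.integerNormalization_spec (nonZeroDivisors ℤ) P
  set Q := IsLocalization.integerNormalization (nonZeroDivisors ℤ) P
  have hb0 : b ≠ 0 := nonZeroDivisors.ne_zero hb
  have hP : aeval ζ P = ε := hP
  have hQ : aeval ζ Q = b * ε := by
    rw [← hP, ← aeval_map_algebraMap ℚ, hbP, map_zsmul, zsmul_eq_mul]
  have hG : aeval ζ (Q ^ 2 - C (b ^ 2 * d)) = 0 := by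
    rw [map_sub, map_pow, hQ, aeval_C, mul_pow, hε]
    simp
  have hdvd : cyclotomic n ℤ ∣ Q ^ 2 - C (b ^ 2 * d) := by
    rw [cyclotomic_eq_minpoly hζ (NeZero.pos n)]
    exact minpoly.isIntegrallyClosed_dvd (hζ.isIntegral (NeZero.pos n)) hG
  refine ⟨b.natAbs, fun l hl hlp hln => ?_⟩
  have hnl : n ∣ l - 1 := (Nat.modEq_iff_dvd' hlp.out.one_le).mp hln.symm
  obtain ⟨m, hm⟩ := hnl
  have hl1 : l - 1 ≠ 0 := by have := hlp.out.one_lt; lia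
  obtain ⟨y, hy⟩ := HasEnoughRootsOfUnity.exists_primitiveRoot (ZMod l) (l - 1)
  have hym : IsPrimitiveRoot (y ^ m) n := hy.pow (Nat.pos_of_ne_zero hl1) (by rw [hm, mul_comm])
  have hroot : aeval (y ^ m) (cyclotomic n ℤ) = 0 := by
    have := hym.isRoot_cyclotomic (NeZero.pos n)
    rw [IsRoot.def, ← map_cyclotomic_int, eval_map] at this
    exact this
  have hbl : (b : ZMod l) ≠ 0 := by
    rw [Ne, ZMod.intCast_zmod_eq_zero_iff_dvd]
    intro h
    exact (Nat.le_of_dvd (Int.natAbs_pos.mpr hb0) (Int.natCast_dvd.mp h)).not_gt hl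
  have h0 := aeval_eq_zero_of_dvd_aeval_eq_zero hdvd hroot
  rw [map_sub, map_pow, aeval_C, sub_eq_zero] at h0
  refine ⟨aeval (y ^ m) Q / b, ?_⟩
  rw [div_mul_div_comm, ← sq, ← sq, h0, eq_div_iff (pow_ne_zero 2 hbl)]
  simp [mul_comm]

/-- The conductor of a quadratic field is the absolute value of its discriminant: if the field
lies in the `n`-th cyclotomic field, then its discriminant divides `n`. -/
theorem discr_dvd_of_mem_adjoin (hd : Squarefree d) :
    (if d % 4 = 1 then d else 4 * d) ∣ (n : ℤ) := by
  by_contra h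
  obtain ⟨N, hN⟩ := exists_forall_prime_isSquare hζ hε hmem
  obtain ⟨l, hl, hlp, hln, hdl⟩ := exists_prime_jacobiSym_eq_neg_one hd h N
  exact ZMod.nonsquare_of_jacobiSym_eq_neg_one hdl (hN l hl ⟨hlp⟩ hln)
end Conductor

section Degree
variable {d : ℤ} (hd : Squarefree d) (hd1 : d ≠ 1) {K : Type*} (L : Type*) [Field K] [CharZero K]
  {δ : K} (hδ : δ ^ 2 = (d : K)) (hK : IntermediateField.adjoin ℚ {δ} = ⊤)
  [Field L] [Algebra K L] {n : ℕ} [NeZero n] [IsCyclotomicExtension {n} K L]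
include hd hd1 hδ hK

theorem finrank_cyclotomic_quadratic_of_discr_dvd
    (h : (if d % 4 = 1 then d else 4 * d) ∣ (n : ℤ)) :
    2 * Module.finrank K L = n.totient := by
  have : CharZero L := charZero_of_injective_algebraMap (algebraMap K L).injective
  have hζ := IsCyclotomicExtension.zeta_spec n K L
  refine (finrank_cyclotomic_quadratic hd hd1 hδ hK hζ).1 ?_
  obtain ⟨x, hx, hx2⟩ := exists_sq_eq_of_discr_dvd hζ
    (IntermediateField.adjoin ℚ {IsCyclotomicExtension.zeta n K L}).toSubfield
    (IntermediateField.mem_adjoin_simple_self ℚ _) hd h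
  have : algebraMap K L δ ^ 2 = x ^ 2 := by rw [hx2, ← map_pow, hδ, map_intCast]
  rcases sq_eq_sq_iff_eq_or_eq_neg.mp this with h | h
  · rw [h]; exact hx
  · rw [h]; exact neg_mem hx

theorem finrank_cyclotomic_quadratic_of_not_discr_dvd
    (h : ¬ (if d % 4 = 1 then d else 4 * d) ∣ (n : ℤ)) :
    Module.finrank K L = n.totient := by
  have : CharZero L := charZero_of_injective_algebraMap (algebraMap K L).injective
  have hζ := IsCyclotomicExtension.zeta_spec n K L
  refine (finrank_cyclotomic_quadratic hd hd1 hδ hK hζ).2 fun hmem => h ?_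
  exact discr_dvd_of_mem_adjoin hζ (by rw [← map_pow, hδ, map_intCast]) hmem hd
end Degree

end

/-! ### Integers, discriminant and residue fields of a quadratic field -/

section
open Polynomial NumberField

/-- A rational `w` with `d w²` integral, `d` squarefree, is an integer. -/
theorem Squarefree.exists_intCast_eq_of_mul_sq {d : ℤ} (hd : Squarefree d) {w : ℚ} {k : ℤ}
    (h : d * w ^ 2 = k) : ∃ z : ℤ, (z : ℚ) = w := by
  have hw : (w.num : ℚ) = w * w.den := (Rat.mul_den_eq_num w).symm
  have h1 : d * w.num ^ 2 = k * (w.den : ℤ) ^ 2 := by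
    have : (d * w.num ^ 2 : ℚ) = k * (w.den : ℚ) ^ 2 := by rw [hw, ← h]; ring
    exact_mod_cast this
  have hcop : IsCoprime ((w.den : ℤ) ^ 2) (w.num ^ 2) := by
    apply IsCoprime.pow
    rw [Int.isCoprime_iff_gcd_eq_one, Int.gcd_comm, Int.gcd_eq_natAbs, Int.natAbs_natCast]
    exact w.reduced
  have h2 : (w.den : ℤ) * w.den ∣ d := by
    rw [← sq]
    exact hcop.dvd_of_dvd_mul_right (Dvd.intro_left _ h1.symm)
  have h3 := hd _ h2
  rw [Int.ofNat_isUnit, Nat.isUnit_iff] at h3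
  exact ⟨w.num, by rw [hw, h3]; simp⟩

/-- The condition on the discriminant `D` of a quadratic field for the prime `p` to be inert: the
Legendre symbol is `-1` or, for `p = 2`, `D ≡ 5 (mod 8)`. -/
def IsInertAt (D : ℤ) (p : ℕ) [Fact p.Prime] : Prop :=
  if p = 2 then D % 8 = 5 else legendreSym p D = -1

open Classical in
/-- The size of the residue field at a prime above `p` of the quadratic field of discriminant `D`:
`p²` if `p` is inert and `p` otherwise. -/
noncomputable def residueCard (D : ℤ) (p : ℕ) [Fact p.Prime] : ℕ :=
  if IsInertAt D p then p ^ 2 else p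

theorem residueCard_of_isInertAt {D : ℤ} {p : ℕ} [Fact p.Prime] (h : IsInertAt D p) :
    residueCard D p = p ^ 2 := if_pos h

theorem residueCard_of_not_isInertAt {D : ℤ} {p : ℕ} [Fact p.Prime] (h : ¬ IsInertAt D p) :
    residueCard D p = p := if_neg h

section Integers
variable {d : ℤ} (hd : Squarefree d) (hd1 : d ≠ 1) {K : Type*} [Field K] [CharZero K]
  {δ : K} (hδ : δ ^ 2 = (d : K))

include hδ in
theorem exists_eq_add_mul_sqrt (hK : IntermediateField.adjoin ℚ {δ} = ⊤) (x : K) :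
    ∃ u v : ℚ, x = u + v * δ := by
  have hint : IsIntegral ℚ δ := ⟨X ^ 2 - C (d : ℚ), monic_X_pow_sub_C _ two_ne_zero, by
    rw [eval₂_sub, eval₂_X_pow, eval₂_C, hδ, map_intCast, sub_self]⟩
  have hx : x ∈ Algebra.adjoin ℚ {δ} := by
    rw [← IntermediateField.adjoin_simple_toSubalgebra_of_isAlgebraic hint.isAlgebraic, hK]
    trivial
  induction hx using Algebra.adjoin_induction with
  | mem y hy => exact ⟨0, 1, by simpa using hy⟩
  | algebraMap r => exact ⟨r, 0, by simp⟩
  | add x y _ _ hx hy =>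
    obtain ⟨u, v, rfl⟩ := hx
    obtain ⟨u', v', rfl⟩ := hy
    exact ⟨u + u', v + v', by push_cast; ring⟩
  | mul x y _ _ hx hy =>
    obtain ⟨u, v, rfl⟩ := hx
    obtain ⟨u', v', rfl⟩ := hy
    exact ⟨u * u' + d * v * v', u * v' + u' * v, by
      push_cast; linear_combination (v * v' : K) * hδ⟩

include hd hd1 hδ in
theorem ratCast_add_mul_sqrt_notMem {u v : ℚ} (hv : v ≠ 0) (r : ℚ) :
    (u + v * δ : K) ≠ r := by
  intro h
  refine not_isSquare_of_squarefree hd hd1 ((r - u) / v) ?_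
  have : (δ : K) = ((r - u) / v : ℚ) := by
    push_cast
    rw [eq_div_iff (by exact_mod_cast hv), ← h]; ring
  rw [this] at hδ
  exact_mod_cast hδ

include hd hd1 hδ in
/-- Trace, norm and the coefficient of `δ` of an integral element `u + vδ`. -/
theorem exists_trace_norm_of_isIntegral {u v : ℚ} (hx : IsIntegral ℤ (u + v * δ : K)) :
    ∃ s w m : ℤ, (s : ℚ) = 2 * u ∧ (w : ℚ) = 2 * v ∧ s ^ 2 - d * w ^ 2 = 4 * m := by
  obtain ⟨s, m, hs, hm⟩ : ∃ s m : ℤ, (s : ℚ) = 2 * u ∧ (m : ℚ) = u ^ 2 - d * v ^ 2 := by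
    by_cases hv : v = 0
    · subst hv
      simp only [Rat.cast_zero, zero_mul, add_zero] at hx
      have hu : IsIntegral ℤ u := (isIntegral_algHom_iff
        ((algebraMap ℚ K).toIntAlgHom) (algebraMap ℚ K).injective).mp hx
      obtain ⟨a, rfl⟩ := IsIntegrallyClosed.isIntegral_iff.mp hu
      exact ⟨2 * a, a ^ 2, by simp, by simp⟩
    · set x : K := u + v * δ with hxdef
      have hg : X ^ 2 - C (2 * u) * X + C (u ^ 2 - d * v ^ 2) =
          (minpoly ℤ x).map (algebraMap ℤ ℚ) := by
        rw [← minpoly.isIntegrallyClosed_eq_field_fractions' ℚ hx]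
        have hxq : IsIntegral ℚ x := hx.tower_top
        have hmonic : (X ^ 2 - C (2 * u) * X + C (u ^ 2 - d * v ^ 2) : ℚ[X]).Monic := by
          monicity!
        have hdeg : (X ^ 2 - C (2 * u) * X + C (u ^ 2 - d * v ^ 2) : ℚ[X]).natDegree = 2 := by
          compute_degree!
        refine eq_of_monic_of_dvd_of_natDegree_le (minpoly.monic hxq) hmonic
          (minpoly.dvd ℚ x ?_) ?_
        · simp only [map_add, map_sub, map_pow, aeval_X, map_mul, aeval_C, hxdef]
          simp only [eq_ratCast]
          push_cast
          linear_combination (v ^ 2 : K) * hδ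
        · rw [hdeg]
          refine (minpoly.two_le_natDegree_iff hxq).mpr ?_
          rintro ⟨r, hr⟩
          exact ratCast_add_mul_sqrt_notMem hd hd1 hδ hv r hr.symm
      refine ⟨-(minpoly ℤ x).coeff 1, (minpoly ℤ x).coeff 0, ?_, ?_⟩
      · have := congrArg (fun f => f.coeff 1) hg
        simp only [coeff_map, coeff_add, coeff_sub, coeff_X_pow, coeff_C_mul, coeff_X, coeff_C]
          at this
        simp only [eq_intCast] at this
        push_cast
        rw [← this]; simp
      · have := congrArg (fun f => f.coeff 0) hg
        simp only [coeff_map, coeff_add, coeff_sub, coeff_X_pow, coeff_C_mul, coeff_X, coeff_C]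
          at this
        simp only [eq_intCast] at this
        rw [← this]; simp
  have h4 : (d : ℚ) * (2 * v) ^ 2 = ((s ^ 2 - 4 * m : ℤ) : ℚ) := by
    push_cast; rw [hs, hm]; ring
  obtain ⟨w, hw⟩ := hd.exists_intCast_eq_of_mul_sq h4
  refine ⟨s, w, m, hs, hw, ?_⟩
  rw [← hw] at h4
  have : d * w ^ 2 = s ^ 2 - 4 * m := by exact_mod_cast h4
  lia

variable [NumberField K] (hK : IntermediateField.adjoin ℚ {δ} = ⊤)
include hd hd1 hδ hK

omit [NumberField K] in
/-- The ring of integers of a quadratic field is `ℤ[θ]` with `θ² = tθ + c`, where `t ∈ {0, 1}`. -/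
theorem exists_integral_generator : ∃ (θ : 𝓞 K) (t c : ℤ), θ ^ 2 = t * θ + c ∧
    t ^ 2 + 4 * c = (if d % 4 = 1 then d else 4 * d) ∧ (t = 0 ∨ t = 1) ∧
    (∀ x : 𝓞 K, ∃ a b : ℤ, x = a + b * θ) ∧
    (∀ a b : ℤ, (a + b * θ : 𝓞 K) = 0 → a = 0 ∧ b = 0) := by
  by_cases h : d % 4 = 1
  · rw [if_pos h]
    obtain ⟨c, hc⟩ : ∃ c, d = 1 + 4 * c := ⟨d / 4, by lia⟩
    have hdK : (d : K) = 1 + 4 * c := by rw [hc]; push_cast; ring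
    have hθ : IsIntegral ℤ ((1 + δ) / 2 : K) := by
      refine ⟨X ^ 2 - X - C c, by monicity!, ?_⟩
      simp only [eval₂_sub, eval₂_pow, eval₂_X, eval₂_C]
      rw [eq_intCast]
      linear_combination (1 / 4 : K) * hδ + (1 / 4 : K) * hdK
    obtain ⟨θ, hθ⟩ : ∃ θ : 𝓞 K, algebraMap (𝓞 K) K θ = (1 + δ) / 2 := ⟨⟨_, hθ⟩, rfl⟩
    refine ⟨θ, 1, c, ?_, by lia, Or.inr rfl, ?_, ?_⟩
    · apply RingOfIntegers.ext
      simp only [map_pow, map_add, map_mul, map_intCast, hθ]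
      push_cast
      linear_combination (1 / 4 : K) * hδ + (1 / 4 : K) * hdK
    · intro x
      obtain ⟨u, v, hx⟩ := exists_eq_add_mul_sqrt hδ hK (algebraMap (𝓞 K) K x)
      have hint := RingOfIntegers.isIntegral_coe x
      rw [hx] at hint
      obtain ⟨s, w, m, hs, hw, hm⟩ := exists_trace_norm_of_isIntegral hd hd1 hδ hint
      have hpar : 2 ∣ s - w := by
        have h1 : (s - w) * (s - w) % 2 = 0 := by
          have : (s - w) * (s - w) = 2 * (2 * m + (d + 1) / 2 * w ^ 2 - s * w) := by
            have : d + 1 = 2 * ((d + 1) / 2) := by lia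
            linear_combination hm + w ^ 2 * this
          lia
        exact (Int.prime_two.dvd_mul.mp (Int.dvd_of_emod_eq_zero h1)).elim id id
      obtain ⟨a, ha⟩ := hpar
      refine ⟨a, w, ?_⟩
      apply RingOfIntegers.ext
      simp only [map_add, map_mul, map_intCast, hθ, hx]
      have hs' : (s : K) = 2 * u := by exact_mod_cast congrArg (Rat.cast : ℚ → K) hs
      have hw' : (w : K) = 2 * v := by exact_mod_cast congrArg (Rat.cast : ℚ → K) hw
      have ha' : (s - w : K) = 2 * a := by exact_mod_cast congrArg (Int.cast : ℤ → K) ha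
      linear_combination (-1 / 2 : K) * hs' - (δ / 2 : K) * hw' + (1 / 2 : K) * ha'
    · intro a b hab
      have hab := congrArg (algebraMap (𝓞 K) K) hab
      simp only [map_add, map_mul, map_intCast, hθ, map_zero] at hab
      by_cases hb : b = 0
      · subst hb
        simpa using hab
      · exfalso
        refine ratCast_add_mul_sqrt_notMem hd hd1 hδ (u := a + b / 2) (v := b / 2) ?_ 0 ?_
        · simpa using hb
        · push_cast
          linear_combination hab
  · rw [if_neg h]
    have hθ : IsIntegral ℤ δ := ⟨X ^ 2 - C d, monic_X_pow_sub_C _ two_ne_zero, by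
      rw [eval₂_sub, eval₂_X_pow, eval₂_C, hδ]; simp⟩
    obtain ⟨θ, hθ⟩ : ∃ θ : 𝓞 K, algebraMap (𝓞 K) K θ = δ := ⟨⟨_, hθ⟩, rfl⟩
    refine ⟨θ, 0, d, ?_, by lia, Or.inl rfl, ?_, ?_⟩
    · apply RingOfIntegers.ext
      simpa [hθ] using hδ
    · intro x
      obtain ⟨u, v, hx⟩ := exists_eq_add_mul_sqrt hδ hK (algebraMap (𝓞 K) K x)
      have hint := RingOfIntegers.isIntegral_coe x
      rw [hx] at hint
      obtain ⟨s, w, m, hs, hw, hm⟩ := exists_trace_norm_of_isIntegral hd hd1 hδ hint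
      have hd4 : d % 4 ≠ 0 := fun h0 => by
        have := hd 2 (Int.dvd_of_emod_eq_zero h0)
        rw [Int.isUnit_iff] at this
        lia
      have hpar : s % 2 = 0 ∧ w % 2 = 0 := by
        have hsq : ∀ z : ℤ, z % 2 = 1 → z ^ 2 % 4 = 1 := fun z hz => by
          obtain ⟨y, rfl⟩ : ∃ y, z = 2 * y + 1 := ⟨z / 2, by lia⟩
          have : (2 * y + 1) ^ 2 = 4 * (y ^ 2 + y) + 1 := by ring
          lia
        have hsq0 : ∀ z : ℤ, z % 2 = 0 → z ^ 2 % 4 = 0 := fun z hz => by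
          obtain ⟨y, rfl⟩ : ∃ y, z = 2 * y := ⟨z / 2, by lia⟩
          have : (2 * y) ^ 2 = 4 * y ^ 2 := by ring
          lia
        have hmod : s ^ 2 % 4 = (d % 4) * (w ^ 2 % 4) % 4 := by
          rw [← Int.mul_emod]; lia
        rcases Int.emod_two_eq_zero_or_one w with h1 | h1
        · rw [hsq0 w h1, mul_zero] at hmod
          refine ⟨?_, h1⟩
          rcases Int.emod_two_eq_zero_or_one s with h2 | h2
          · exact h2
          · rw [hsq s h2] at hmod; lia
        · rw [hsq w h1, mul_one] at hmod
          rcases Int.emod_two_eq_zero_or_one s with h2 | h2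
          · rw [hsq0 s h2] at hmod; lia
          · rw [hsq s h2] at hmod; lia
      obtain ⟨a, rfl⟩ := Int.dvd_of_emod_eq_zero hpar.1
      obtain ⟨b, rfl⟩ := Int.dvd_of_emod_eq_zero hpar.2
      push_cast at hs hw
      refine ⟨a, b, ?_⟩
      apply RingOfIntegers.ext
      simp only [map_add, map_mul, map_intCast, hθ, hx]
      obtain rfl : (a : ℚ) = u := by linarith
      obtain rfl : (b : ℚ) = v := by linarith
      push_cast; rfl
    · intro a b hab
      have hab := congrArg (algebraMap (𝓞 K) K) hab
      simp only [map_add, map_mul, map_intCast, hθ, map_zero] at hab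
      by_cases hb : b = 0
      · subst hb
        simpa using hab
      · exfalso
        refine ratCast_add_mul_sqrt_notMem hd hd1 hδ (u := a) (v := b) ?_ 0 ?_
        · simpa using hb
        · push_cast
          linear_combination hab

theorem discr_eq : NumberField.discr K = if d % 4 = 1 then d else 4 * d := by
  obtain ⟨θ, t, c, hθ, htc, -, hspan, hli⟩ := exists_integral_generator hd hd1 hδ hK
  have li : LinearIndependent ℤ ![1, θ] := by
    rw [LinearIndependent.pair_iff]
    intro a b hab
    exact hli a b (by simpa using hab)
  have sp : ⊤ ≤ Submodule.span ℤ (Set.range ![1, θ]) := by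
    intro x _
    obtain ⟨a, b, rfl⟩ := hspan x
    rw [Matrix.range_cons, Matrix.range_cons, Matrix.range_empty, Set.union_empty,
      Set.singleton_union, Submodule.mem_span_pair]
    exact ⟨a, b, by simp⟩
  let b : Module.Basis (Fin 2) ℤ (𝓞 K) := Module.Basis.mk li sp
  have hb0 : b 0 = 1 := by simp [b]
  have hb1 : b 1 = θ := by simp [b]
  have htr1 : Algebra.trace ℤ (𝓞 K) 1 = 2 := by
    simpa using Algebra.trace_algebraMap_of_basis b 1
  have hrep : ∀ x y : ℤ, b.repr (x + y * θ) = Finsupp.single 0 x + Finsupp.single 1 y := by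
    intro x y
    have : (x + y * θ : 𝓞 K) = x • b 0 + y • b 1 := by simp [hb0, hb1]
    rw [this, map_add, map_zsmul, map_zsmul, b.repr_self, b.repr_self]
    simp
  have htrθ : Algebra.trace ℤ (𝓞 K) θ = t := by
    have h0 : θ * b 0 = (0 : ℤ) + (1 : ℤ) * θ := by simp [hb0]
    have h1 : θ * b 1 = (c : ℤ) + (t : ℤ) * θ := by rw [hb1, ← sq, hθ, add_comm]
    rw [Algebra.trace_eq_matrix_trace b, Matrix.trace_fin_two, Algebra.leftMulMatrix_eq_repr_mul,
      Algebra.leftMulMatrix_eq_repr_mul, h0, h1, hrep, hrep]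
    simp
  have htrθ2 : Algebra.trace ℤ (𝓞 K) (θ * θ) = t * t + 2 * c := by
    have h : θ * θ = t • θ + c • (1 : 𝓞 K) := by rw [← sq, hθ]; simp
    rw [h, map_add, map_zsmul, map_zsmul, htrθ, htr1]
    simp [mul_comm]
  rw [← NumberField.discr_eq_discr K b, Algebra.discr_def, Matrix.det_fin_two, ← htc]
  simp only [Algebra.traceMatrix_apply, Algebra.traceForm_apply, hb0, hb1, one_mul, mul_one, htr1,
    htrθ, htrθ2]
  ring

section Residue
variable (𝔭 : Ideal (𝓞 K)) [𝔭.IsPrime] (h𝔭 : 𝔭 ≠ ⊥) {p : ℕ} [Fact p.Prime]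
  (hp : 𝔭.under ℤ = Ideal.span {(p : ℤ)})

omit hd hd1 hδ hK [CharZero K] [NumberField K] [𝔭.IsPrime] [Fact p.Prime] in
include hp in
theorem charP_quotient : CharP (𝓞 K ⧸ 𝔭) p := by
  refine ⟨fun m => ?_⟩
  have : ((m : ℕ) : 𝓞 K ⧸ 𝔭) = Ideal.Quotient.mk 𝔭 (algebraMap ℤ (𝓞 K) m) := by simp
  rw [this, Ideal.Quotient.eq_zero_iff_mem, ← Ideal.mem_comap, ← Ideal.under_def, hp,
    Ideal.mem_span_singleton, Int.natCast_dvd_natCast]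

include h𝔭 hp in
/-- The residue field is generated over `𝔽_p` by the class of `θ`; it has `p²` elements exactly
when the polynomial `X² - tX - c` of discriminant `Δ` has no root modulo `p`. -/
theorem card_quotient : Nat.card (𝓞 K ⧸ 𝔭) = residueCard (NumberField.discr K) p := by
  have := charP_quotient 𝔭 hp
  have hmax : 𝔭.IsMaximal := Ideal.IsPrime.isMaximal inferInstance h𝔭
  let _ := Ideal.Quotient.field 𝔭
  obtain ⟨θ, t, c, hθ, htc, ht, hspan, -⟩ := exists_integral_generator hd hd1 hδ hK
  rw [discr_eq hd hd1 hδ hK, ← htc]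
  set π := Ideal.Quotient.mk 𝔭
  let f : ZMod p →+* 𝓞 K ⧸ 𝔭 := ZMod.castHom dvd_rfl _
  have hf : Function.Injective f := f.injective
  have hθ' : π θ ^ 2 = f t * π θ + f c := by
    rw [← map_pow, hθ]; simp
  have hspan' : ∀ y, ∃ a b : ZMod p, y = f a + f b * π θ := by
    intro y
    obtain ⟨x, rfl⟩ := Ideal.Quotient.mk_surjective y
    obtain ⟨a, b, rfl⟩ := hspan x
    exact ⟨a, b, by simp [π]⟩
  have hcase : IsInertAt (t ^ 2 + 4 * c) p ↔ ¬ ∃ r : ZMod p, r ^ 2 = t * r + c := by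
    unfold IsInertAt
    split_ifs with h2
    · subst h2
      rcases ht with rfl | rfl
      · simp only [Int.cast_zero, zero_mul, zero_add]
        constructor
        · intro h; lia
        · intro h
          exfalso
          apply h
          exact ⟨c, ZMod.pow_card _⟩
      · constructor
        · rintro h ⟨r, hr⟩
          have hc : c % 2 = 1 := by lia
          have hc' : (c : ZMod 2) = 1 := by
            have := (ZMod.intCast_eq_intCast_iff_dvd_sub 1 c 2).mpr (by push_cast; lia)
            simpa using this.symm
          rw [hc', ZMod.pow_card] at hr
          simp at hr
        · intro h
          by_contra h5
          have hc : c % 2 = 0 := by lia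
          have hc' : (c : ZMod 2) = 0 := by
            rw [ZMod.intCast_zmod_eq_zero_iff_dvd]; push_cast; lia
          exact h ⟨0, by rw [hc']; simp⟩
    · rw [legendreSym.eq_neg_one_iff, not_iff_not]
      have h2' : (2 : ZMod p) ≠ 0 := by
        have : ((2 : ℕ) : ZMod p) ≠ 0 := by
          rw [Ne, ZMod.natCast_eq_zero_iff, Nat.prime_dvd_prime_iff_eq Fact.out Nat.prime_two]
          exact h2
        exact_mod_cast this
      push_cast
      constructor
      · rintro ⟨y, hy⟩
        refine ⟨(y + t) / 2, ?_⟩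
        field_simp
        linear_combination -hy
      · rintro ⟨r, hr⟩
        exact ⟨2 * r - t, by linear_combination -4 * hr⟩
  by_cases h : ∃ r : ZMod p, r ^ 2 = t * r + c
  swap
  · rw [residueCard_of_isInertAt (hcase.mpr h)]
    have hbij : Function.Bijective (fun ab : ZMod p × ZMod p => f ab.1 + f ab.2 * π θ) := by
      constructor
      · rintro ⟨a, b⟩ ⟨a', b'⟩ hab
        simp only at hab
        have hb : b = b' := by
          by_contra hb
          have hne : f (b - b') ≠ 0 := (map_ne_zero_iff f hf).mpr (sub_ne_zero.mpr hb)
          apply h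
          refine ⟨(a' - a) / (b - b'), hf ?_⟩
          have : f ((a' - a) / (b - b')) = π θ := by
            rw [map_div₀, div_eq_iff hne, map_sub, map_sub]
            linear_combination -hab
          rw [map_pow, map_add, map_mul, this, hθ']
        subst hb
        have := hf (add_right_cancel hab)
        rw [this]
      · intro y
        obtain ⟨a, b, rfl⟩ := hspan' y
        exact ⟨(a, b), rfl⟩
    rw [← Nat.card_congr (Equiv.ofBijective _ hbij), Nat.card_prod, Nat.card_zmod, sq]
  · rw [residueCard_of_not_isInertAt (mt hcase.mp (not_not.mpr h))]
    obtain ⟨r, hr⟩ := h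
    -- the two roots of `X² - tX - c` in the residue field are `r` and `t - r`
    have hθr : ∃ s, π θ = f s := by
      have h0 : (π θ - f r) * (π θ - f (t - r)) = 0 := by
        have hr' := congrArg f hr
        rw [map_pow, map_add, map_mul] at hr'
        rw [map_sub]
        linear_combination hθ' - hr'
      rcases mul_eq_zero.mp h0 with h | h
      · exact ⟨_, sub_eq_zero.mp h⟩
      · exact ⟨_, sub_eq_zero.mp h⟩
    obtain ⟨s, hs⟩ := hθr
    have hbij : Function.Bijective f := ⟨hf, fun y => by
      obtain ⟨a, b, rfl⟩ := hspan' y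
      exact ⟨a + b * s, by rw [map_add, map_mul, hs]⟩⟩
    rw [← Nat.card_congr (Equiv.ofBijective _ hbij), Nat.card_zmod]
end Residue
end Integers

end

/-! ### Cleanness over localizations of the ring of integers of a quadratic field -/

section
open NumberField IsLocalRing

/-- The largest divisor prime to `p` is complementary to a power of `p`. -/
theorem exists_exponent_eq_pow_mul {p : ℕ} (hp : p.Prime) {E n : ℕ} (hE : E ≠ 0)
    (hn : IsGreatest {m : ℕ | m ∣ E ∧ ¬ p ∣ m} n) : ∃ a, E = p ^ a * n := by
  obtain ⟨⟨hnE, hpn⟩, hmax⟩ := hn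
  obtain ⟨a, m, hpm, hm⟩ := Nat.exists_eq_pow_mul_and_not_dvd hE p hp.ne_one
  have h1 : n ∣ m := by
    rw [hm] at hnE
    exact Nat.Coprime.dvd_of_dvd_mul_left
      (((hp.coprime_iff_not_dvd.mpr hpn).symm).pow_right a) hnE
  have hm0 : m ≠ 0 := by rintro rfl; simp at hpm
  have h2 : m ≤ n := hmax ⟨hm ▸ dvd_mul_left _ _, hpm⟩
  exact ⟨a, by rw [hm, (Nat.le_of_dvd (Nat.pos_of_ne_zero hm0) h1).antisymm h2]⟩

section
variable {d : ℤ} (hd : Squarefree d) (hd1 : d ≠ 1) {K : Type*} [Field K] [NumberField K]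
  {δ : K} (hδ : δ ^ 2 = (d : K)) (hK : IntermediateField.adjoin ℚ {δ} = ⊤)
  (𝔭 : Ideal (𝓞 K)) [𝔭.IsPrime] (h𝔭 : 𝔭 ≠ ⊥) {p : ℕ} [Fact p.Prime]
  (hp : 𝔭.under ℤ = Ideal.span {(p : ℤ)})
  {G : Type*} [CommGroup G] [Finite G]
  {n : ℕ} (hn : IsGreatest {m : ℕ | m ∣ Monoid.exponent G ∧ ¬ p ∣ m} n)

include h𝔭 hp hn in
theorem isCleanRing_localization_iff_orderOf [NeZero n] (L : Type*) [Field L] [Algebra K L]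
    [IsCyclotomicExtension {n} K L] :
    IsCleanRing (MonoidAlgebra (Localization.AtPrime 𝔭) G) ↔
      orderOf (Nat.card (𝓞 K ⧸ 𝔭) : ZMod n) = Module.finrank K L := by
  have hmax : 𝔭.IsMaximal := Ideal.IsPrime.isMaximal inferInstance h𝔭
  obtain ⟨a, ha⟩ := exists_exponent_eq_pow_mul (p := p) Fact.out
    Monoid.exponent_ne_zero_of_finite hn
  let R := Localization.AtPrime 𝔭
  have hle : 𝔭.primeCompl ≤ nonZeroDivisors (𝓞 K) := 𝔭.primeCompl_le_nonZeroDivisors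
  let _ : Algebra R K := (IsLocalization.lift (M := 𝔭.primeCompl) (S := R)
    (g := algebraMap (𝓞 K) K) fun y => by
      rw [isUnit_iff_ne_zero, Ne, FaithfulSMul.algebraMap_eq_zero_iff]
      rintro h
      exact y.2 (h ▸ 𝔭.zero_mem)).toAlgebra
  have : IsScalarTower (𝓞 K) R K := .of_algebraMap_eq fun x => (IsLocalization.lift_eq _ x).symm
  have : IsFractionRing R K :=
    IsFractionRing.isFractionRing_of_isDomain_of_isLocalization 𝔭.primeCompl R K
  have : IsIntegrallyClosed R := isIntegrallyClosed_of_isLocalization R 𝔭.primeCompl hle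
  let e : 𝓞 K ⧸ 𝔭 ≃+* ResidueField R := IsLocalization.AtPrime.equivQuotMaximalIdeal 𝔭 R
  have : Finite (𝓞 K ⧸ 𝔭) := Ideal.finiteQuotientOfFreeOfNeBot 𝔭 h𝔭
  have : Finite (ResidueField R) := Finite.of_equiv _ e.toEquiv
  have := charP_quotient 𝔭 hp
  have : CharP (ResidueField R) p := charP_of_injective_ringHom (f := e.toRingHom) e.injective p
  rw [isCleanRing_monoidAlgebra_iff_orderOf (R := R) (K := K) L ha hn.1.2, Nat.card_congr e.toEquiv]

include hd hd1 hδ hK h𝔭 hp hn in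
/-- The group ring is clean if and only if the size of the residue field generates the Galois
group of the `n`-th cyclotomic extension of `K`, seen as a subgroup of `(ℤ/n)ˣ`. -/
theorem isCleanRing_localization_iff_ordMod :
    (¬ NumberField.discr K ∣ (n : ℤ) → (IsCleanRing (MonoidAlgebra (Localization.AtPrime 𝔭) G) ↔
      ordMod n (residueCard (NumberField.discr K) p) = n.totient)) ∧
    (NumberField.discr K ∣ (n : ℤ) → (IsCleanRing (MonoidAlgebra (Localization.AtPrime 𝔭) G) ↔
      2 * ordMod n (residueCard (NumberField.discr K) p) = n.totient)) := by
  have hn0 : n ≠ 0 := fun h => hn.1.2 (h ▸ dvd_zero p)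
  have : NeZero n := ⟨hn0⟩
  rw [isCleanRing_localization_iff_orderOf 𝔭 h𝔭 hp hn (CyclotomicField n K), ordMod,
    ← card_quotient hd hd1 hδ hK 𝔭 h𝔭 hp, discr_eq hd hd1 hδ hK]
  constructor
  · intro h
    rw [finrank_cyclotomic_quadratic_of_not_discr_dvd hd hd1 (CyclotomicField n K) hδ hK h]
  · intro h
    rw [← finrank_cyclotomic_quadratic_of_discr_dvd hd hd1 (CyclotomicField n K) hδ hK h]
    lia
end

end

/-! ### Multiplicative orders -/

section Order
variable {a m n k : ℕ}

theorem ordMod_dvd_iff : ordMod n a ∣ k ↔ a ^ k ≡ 1 [MOD n] := by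
  rw [ordMod, orderOf_dvd_iff_pow_eq_one, ← ZMod.natCast_eq_natCast_iff]
  push_cast
  rfl

theorem ordMod_mul (h : m.Coprime n) : ordMod (m * n) a = (ordMod m a).lcm (ordMod n a) := by
  refine Nat.dvd_left_injective ?_
  ext k
  change _ ∣ k ↔ _ ∣ k
  rw [Nat.lcm_dvd_iff, ordMod_dvd_iff, ordMod_dvd_iff, ordMod_dvd_iff,
    Nat.modEq_and_modEq_iff_modEq_mul h]

theorem ordMod_dvd_totient (h : a.Coprime n) : ordMod n a ∣ n.totient :=
  ordMod_dvd_iff.mpr (Nat.ModEq.pow_totient h)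

theorem ordMod_pos (h : a.Coprime n) (hn : 0 < n) : 0 < ordMod n a :=
  Nat.pos_of_dvd_of_pos (ordMod_dvd_totient h) (Nat.totient_pos.mpr hn)

theorem ordMod_one : ordMod 1 a = 1 :=
  Nat.dvd_one.mp (ordMod_dvd_iff.mpr (Nat.modEq_one))

theorem ordMod_two (h : a.Coprime 2) : ordMod 2 a = 1 :=
  Nat.dvd_one.mp (ordMod_dvd_totient h)

theorem ordMod_two_mul (h : a.Coprime (2 * m)) (hm : Odd m) : ordMod (2 * m) a = ordMod m a := by
  rw [ordMod_mul (Nat.coprime_two_left.mpr hm),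
    ordMod_two (h.coprime_dvd_right (dvd_mul_right _ _)), Nat.lcm_one_left]

theorem totient_two_mul (hm : Odd m) : (2 * m).totient = m.totient := by
  rw [Nat.totient_mul (Nat.coprime_two_left.mpr hm), Nat.totient_two, one_mul]

theorem even_totient (hm : 2 < m) : 2 ∣ m.totient := (Nat.totient_even hm).two_dvd

/-- The order of `a` modulo `mn` measured against `φ(mn)`: the loss is the product of the indices
modulo `m` and `n` and of the greatest common divisor of the orders. -/
theorem exists_totient_mul_eq (hmn : m.Coprime n) (h : a.Coprime (m * n)) (hpos : 0 < m * n) :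
    ∃ u w, m.totient = ordMod m a * u ∧ n.totient = ordMod n a * w ∧
      (m * n).totient = ordMod (m * n) a * (u * w * (ordMod m a).gcd (ordMod n a)) ∧
      0 < ordMod m a ∧ 0 < ordMod n a ∧ 0 < ordMod (m * n) a := by
  obtain ⟨u, hu⟩ := ordMod_dvd_totient (h.coprime_dvd_right (dvd_mul_right m n))
  obtain ⟨w, hw⟩ := ordMod_dvd_totient (h.coprime_dvd_right (dvd_mul_left n m))
  refine ⟨u, w, hu, hw, ?_, ordMod_pos (h.coprime_dvd_right (dvd_mul_right m n))
    (Nat.pos_of_mul_pos_right hpos), ordMod_pos (h.coprime_dvd_right (dvd_mul_left n m))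
    (Nat.pos_of_mul_pos_left hpos), ordMod_pos h hpos⟩
  rw [Nat.totient_mul hmn, hu, hw, ordMod_mul hmn]
  have := Nat.gcd_mul_lcm (ordMod m a) (ordMod n a)
  linear_combination (u * w) * this.symm

theorem ordMod_mul_eq_totient_iff (hmn : m.Coprime n) (h : a.Coprime (m * n)) (hpos : 0 < m * n) :
    ordMod (m * n) a = (m * n).totient ↔
      ordMod m a = m.totient ∧ ordMod n a = n.totient ∧ (ordMod m a).gcd (ordMod n a) = 1 := by
  obtain ⟨u, w, hu, hw, huw, hm0, hn0, h0⟩ := exists_totient_mul_eq hmn h hpos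
  rw [hu, hw, huw, left_eq_mul₀ hm0.ne', left_eq_mul₀ hn0.ne', left_eq_mul₀ h0.ne']
  simp [and_assoc]

/-- An element has index two modulo a coprime product `mn` in exactly three ways: index two modulo
one factor, a primitive root modulo the other and coprime orders (two ways), or a primitive root
modulo both and orders with greatest common divisor two. -/
theorem two_mul_ordMod_mul_iff (hmn : m.Coprime n) (h : a.Coprime (m * n)) (hpos : 0 < m * n) :
    2 * ordMod (m * n) a = (m * n).totient ↔
      (2 * ordMod m a = m.totient ∧ ordMod n a = n.totient ∧ (ordMod m a).gcd (ordMod n a) = 1) ∨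
      (ordMod m a = m.totient ∧ 2 * ordMod n a = n.totient ∧ (ordMod m a).gcd (ordMod n a) = 1) ∨
      (ordMod m a = m.totient ∧ ordMod n a = n.totient ∧ (ordMod m a).gcd (ordMod n a) = 2) := by
  obtain ⟨u, w, hu, hw, huw, hm0, hn0, h0⟩ := exists_totient_mul_eq hmn h hpos
  rw [hu, hw, huw, left_eq_mul₀ hm0.ne', left_eq_mul₀ hn0.ne', mul_comm 2, mul_comm 2,
    mul_comm 2, Nat.mul_left_cancel_iff h0, Nat.mul_left_cancel_iff hm0,
    Nat.mul_left_cancel_iff hn0]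
  generalize (ordMod m a).gcd (ordMod n a) = g
  constructor
  · intro h2
    have hg : u * w ∣ 2 := ⟨g, h2⟩
    have hu2 : u ∣ 2 := (dvd_mul_right u w).trans hg
    have hw2 : w ∣ 2 := (dvd_mul_left w u).trans hg
    rcases (Nat.dvd_prime Nat.prime_two).mp hu2 with rfl | rfl <;>
    rcases (Nat.dvd_prime Nat.prime_two).mp hw2 with rfl | rfl <;> lia
  · rintro (⟨rfl, rfl, rfl⟩ | ⟨rfl, rfl, rfl⟩ | ⟨rfl, rfl, rfl⟩) <;> rfl

/-- A square is a primitive root modulo `n` only if `n` is `1` or `2`, since `φ(n)` is even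
otherwise. -/
theorem ordMod_sq_eq_totient_iff (h : a.Coprime n) (hn : 0 < n) :
    ordMod n (a ^ 2) = n.totient ↔ n = 1 ∨ n = 2 := by
  constructor
  · intro ho
    by_contra hn2
    obtain ⟨t, ht⟩ := even_totient (m := n) (by lia)
    have h1 : ordMod n (a ^ 2) ∣ t := by
      rw [ordMod_dvd_iff, ← pow_mul, ← ht]
      exact Nat.ModEq.pow_totient h
    have htpos := Nat.totient_pos.mpr hn
    have := Nat.le_of_dvd (by lia) h1
    lia
  · have := ordMod_dvd_totient (h.pow_left 2)
    rintro (rfl | rfl) <;> simpa using this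

/-- A square is not a primitive root modulo `m > 2`; so if its index modulo the coprime product `mn`
is two, then it is a primitive root modulo `n`. -/
theorem eq_one_or_two_of_two_mul_ordMod_sq (hmn : m.Coprime n) (h : a.Coprime (m * n))
    (hpos : 0 < m * n) (ho : 2 * ordMod (m * n) (a ^ 2) = (m * n).totient) (hm : 2 < m) :
    n = 1 ∨ n = 2 := by
  have hm' := ordMod_sq_eq_totient_iff (h.coprime_dvd_right (dvd_mul_right m n))
    (Nat.pos_of_mul_pos_right hpos)
  have hn' := ordMod_sq_eq_totient_iff (h.coprime_dvd_right (dvd_mul_left n m))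
    (Nat.pos_of_mul_pos_left hpos)
  rw [two_mul_ordMod_mul_iff hmn (h.pow_left 2) hpos, hm', hn'] at ho
  lia

theorem ordMod_sq : ordMod n (a ^ 2) = ordMod n a / (ordMod n a).gcd 2 := by
  rw [ordMod, ordMod, Nat.cast_pow, orderOf_pow' _ two_ne_zero]

theorem ordMod_sq_of_odd (h : Odd (ordMod n a)) : ordMod n (a ^ 2) = ordMod n a := by
  rw [ordMod_sq, (Nat.coprime_two_right.mpr h).gcd_eq_one, Nat.div_one]

theorem two_mul_ordMod_sq_of_even (h : 2 ∣ ordMod n a) : 2 * ordMod n (a ^ 2) = ordMod n a := by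
  rw [ordMod_sq, Nat.gcd_eq_right h, Nat.mul_div_cancel' h]

/-! ### Orders modulo powers of two -/

/-- Each squaring gains a factor `2` in the modulus. -/
theorem pow_two_pow_modEq_one {j : ℕ} (hj : 1 ≤ j) (h : a ≡ 1 [MOD 2 ^ j]) (k : ℕ) :
    a ^ 2 ^ k ≡ 1 [MOD 2 ^ (j + k)] := by
  induction k with
  | zero => simpa using h
  | succ k ih =>
    have h2 : a ^ 2 ^ k ≡ 1 [MOD 2] :=
      ih.of_dvd (dvd_pow_self 2 (by lia))
    rw [Nat.ModEq.comm, Nat.modEq_iff_dvd] at ih h2 ⊢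
    push_cast at ih h2 ⊢
    rw [pow_succ 2 k, pow_mul, show (a ^ 2 ^ k : ℤ) ^ 2 - 1 = (a ^ 2 ^ k - 1) * (a ^ 2 ^ k + 1) by
      ring, ← add_assoc, pow_succ]
    exact mul_dvd_mul ih (by lia)

theorem ordMod_two_pow_dvd_of_one_mod_four (h : a % 4 = 1) (k : ℕ) :
    ordMod (2 ^ (k + 2)) a ∣ 2 ^ k := by
  rw [ordMod_dvd_iff, add_comm]
  exact pow_two_pow_modEq_one (by norm_num) (show a ≡ 1 [MOD 2 ^ 2] from h) k

theorem ordMod_two_pow_dvd_of_one_mod_eight (h : a % 8 = 1) (k : ℕ) :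
    ordMod (2 ^ (k + 3)) a ∣ 2 ^ k := by
  rw [ordMod_dvd_iff, add_comm]
  exact pow_two_pow_modEq_one (by norm_num) (show a ≡ 1 [MOD 2 ^ 3] from h) k

theorem sq_mod_eight (h : Odd a) : a ^ 2 % 8 = 1 := by
  rw [Nat.odd_iff] at h
  rw [Nat.pow_mod]
  have : a % 8 = 1 ∨ a % 8 = 3 ∨ a % 8 = 5 ∨ a % 8 = 7 := by lia
  rcases this with h | h | h | h <;> simp [h]

theorem ordMod_two_pow_dvd (h : Odd a) (k : ℕ) : ordMod (2 ^ (k + 3)) a ∣ 2 ^ (k + 1) := by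
  have := ordMod_two_pow_dvd_of_one_mod_eight (sq_mod_eight h) k
  rw [ordMod_dvd_iff] at this ⊢
  rwa [← pow_mul, ← pow_succ'] at this

theorem totient_two_pow (k : ℕ) : (2 ^ (k + 1)).totient = 2 ^ k := by
  rw [Nat.totient_prime_pow_succ Nat.prime_two]; simp

theorem ordMod_four_of_one (h : a % 4 = 1) : ordMod 4 a = 1 := by
  simpa using ordMod_two_pow_dvd_of_one_mod_four h 0

theorem ordMod_four_of_three (h : a % 4 = 3) : ordMod 4 a = 2 := by
  have h1 : ordMod 4 a ∣ 2 :=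
    ordMod_dvd_totient (n := 4) ((Nat.coprime_two_right.mpr (Nat.odd_iff.mpr (by lia))).pow_right 2)
  rcases (Nat.dvd_prime Nat.prime_two).mp h1 with h1 | h1
  · have h2 : ordMod 4 a ∣ 1 := by rw [h1]
    rw [ordMod_dvd_iff, pow_one] at h2
    unfold Nat.ModEq at h2
    lia
  · exact h1

theorem totient_four : Nat.totient 4 = 2 := by decide

/-- If `4 ∣ n` and `a²` has index two modulo `n`, then `n = 4`. -/
theorem eq_four_of_two_mul_ordMod_sq (h : a.Coprime n) (hn : 0 < n) (h4 : 4 ∣ n)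
    (ho : 2 * ordMod n (a ^ 2) = n.totient) : n = 4 := by
  obtain ⟨k, m, hm, rfl⟩ := Nat.exists_eq_two_pow_mul_odd hn.ne'
  have hk : 2 ≤ k := by
    have := (Nat.Coprime.dvd_of_dvd_mul_right
      ((Nat.coprime_two_left.mpr hm).pow_left 2 : (2 ^ 2).Coprime m) h4)
    exact (Nat.pow_dvd_pow_iff_le_right (by norm_num)).mp this
  have h2k : 2 < 2 ^ k := lt_of_lt_of_le (by norm_num) (Nat.pow_le_pow_right (by norm_num) hk)
  have ha : Odd a := Nat.coprime_two_right.mp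
    (h.coprime_dvd_right ((dvd_pow_self 2 (by lia)).trans (dvd_mul_right _ _)))
  rcases eq_one_or_two_of_two_mul_ordMod_sq ((Nat.coprime_two_left.mpr hm).pow_left k) h hn ho h2k
    with rfl | rfl
  · rw [mul_one] at ho ⊢
    obtain ⟨k, rfl⟩ := Nat.exists_eq_add_of_le' hk
    rcases k with _ | k
    · rfl
    · exfalso
      have h1 := Nat.le_of_dvd (by positivity)
        (ordMod_two_pow_dvd_of_one_mod_eight (sq_mod_eight ha) k)
      have h2 : (2 ^ (k + 1 + 2)).totient = 2 ^ (k + 2) := totient_two_pow (k + 2)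
      rw [show k + 1 + 2 = k + 3 by ring] at ho h2
      rw [h2] at ho
      have : 2 ^ (k + 2) = 4 * 2 ^ k := by ring
      have : 0 < 2 ^ k := by positivity
      lia
  · exact absurd hm (by decide)

/-- If `a` has index two modulo `2^k m` with `m > 1` odd, then `k ≤ 2`. -/
theorem le_two_of_two_mul_ordMod (hm : Odd m) (hm1 : m ≠ 1) (h : a.Coprime (2 ^ k * m))
    (ho : 2 * ordMod (2 ^ k * m) a = (2 ^ k * m).totient) : k ≤ 2 := by
  by_contra hk
  obtain ⟨k, rfl⟩ := Nat.exists_eq_add_of_le' (by lia : 3 ≤ k)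
  have ha : Odd a := Nat.coprime_two_right.mp
    (h.coprime_dvd_right ((dvd_pow_self 2 (by lia)).trans (dvd_mul_right _ _)))
  have hm2 : 2 < m := by have := Nat.odd_iff.mp hm; lia
  rw [two_mul_ordMod_mul_iff ((Nat.coprime_two_left.mpr hm).pow_left _) h (by positivity),
    (totient_two_pow (k + 2) : Nat.totient (2 ^ (k + 3)) = 2 ^ (k + 2))] at ho
  have h1 := Nat.le_of_dvd (by positivity) (ordMod_two_pow_dvd ha k)
  have h2 : 2 ^ (k + 2) = 2 * 2 ^ (k + 1) := by ring
  have h3 : 0 < 2 ^ (k + 1) := by positivity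
  rcases ho with ⟨ho1, ho2, ho3⟩ | ⟨ho1, -⟩ | ⟨ho1, -⟩
  · have : 2 ∣ (ordMod (2 ^ (k + 3)) a).gcd (ordMod m a) := by
      refine Nat.dvd_gcd ?_ (ho2 ▸ even_totient hm2)
      have : ordMod (2 ^ (k + 3)) a = 2 * 2 ^ k := by
        have : 2 ^ (k + 2) = 2 * (2 * 2 ^ k) := by ring
        lia
      exact ⟨_, this⟩
    rw [ho3] at this
    lia
  · lia
  · lia

end Order

/-! ### Orders modulo odd prime powers and quadratic residues -/

section PrimePowers
variable {a m n : ℕ}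

theorem exists_eq_prime_pow_mul {q : ℕ} (hq : q.Prime) (hn : n ≠ 0) (hqn : q ∣ n) :
    ∃ l m, 1 ≤ l ∧ (q ^ l).Coprime m ∧ n = q ^ l * m := by
  obtain ⟨l, m, hm, rfl⟩ := Nat.exists_eq_pow_mul_and_not_dvd hn q hq.ne_one
  refine ⟨l, m, ?_, ((hq.coprime_iff_not_dvd).mpr hm).pow_left l, rfl⟩
  rcases l with _ | l
  · rw [pow_zero, one_mul] at hqn; exact absurd hqn hm
  · lia

theorem two_lt_prime_pow {q l : ℕ} (hq : q.Prime) (hq2 : q ≠ 2) (hl : 1 ≤ l) : 2 < q ^ l :=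
  lt_of_lt_of_le (lt_of_le_of_ne hq.two_le hq2.symm) (Nat.le_self_pow (by lia) q)

/-- An odd modulus `m > 1` with a primitive root, or for which some element of odd order has index
two, is a prime power. -/
theorem exists_eq_prime_pow (hm : Odd m) (hm1 : m ≠ 1) (h : a.Coprime m)
    (ho : ordMod m a = m.totient ∨ (2 * ordMod m a = m.totient ∧ Odd (ordMod m a)))
    {q : ℕ} (hq : q.Prime) (hqm : q ∣ m) :
    ∃ l, 1 ≤ l ∧ m = q ^ l := by
  have hm0 : m ≠ 0 := by rintro rfl; simp at hm
  obtain ⟨l, m', hl, hcop, rfl⟩ := exists_eq_prime_pow_mul hq hm0 hqm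
  refine ⟨l, hl, ?_⟩
  have hm' : Odd m' := (Nat.odd_mul.mp hm).2
  have hq2 : q ≠ 2 := by
    rintro rfl
    exact absurd hm (Nat.not_odd_iff_even.mpr (even_iff_two_dvd.mpr hqm))
  by_contra hne
  have hm1' : m' ≠ 1 := by rintro rfl; simp at hne
  have hm2' : 2 < m' := by have := Nat.odd_iff.mp hm'; lia
  have h1 := even_totient (two_lt_prime_pow hq hq2 hl)
  have h2 := even_totient hm2'
  rcases ho with ho | ⟨ho, hodd⟩
  · rw [ordMod_mul_eq_totient_iff hcop h (Nat.pos_of_ne_zero hm0)] at ho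
    have := Nat.dvd_gcd (ho.1 ▸ h1) (ho.2.1 ▸ h2)
    rw [ho.2.2] at this
    lia
  · rw [Nat.totient_mul hcop] at ho
    obtain ⟨x, hx⟩ := h1
    obtain ⟨y, hy⟩ := h2
    have : ordMod (q ^ l * m') a = 2 * (x * y) := by
      rw [hx, hy] at ho
      have : 2 * x * (2 * y) = 2 * (2 * (x * y)) := by ring
      lia
    rw [this] at hodd
    exact absurd hodd (by simp)

variable {q l : ℕ} (hq : q.Prime) (hq2 : q ≠ 2) (hl : 1 ≤ l)
include hq hl

theorem totient_prime_pow_eq : (q ^ l).totient = q ^ (l - 1) * (q - 1) :=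
  Nat.totient_prime_pow hq hl

include hq2

theorem totient_prime_pow_eq_two_mul :
    (q ^ l).totient = 2 * (q ^ (l - 1) * ((q - 1) / 2)) := by
  rw [totient_prime_pow_eq hq hl]
  have := Nat.odd_iff.mp (hq.odd_of_ne_two hq2)
  have h2 : q - 1 = 2 * ((q - 1) / 2) := by lia
  conv_lhs => rw [h2]
  ring

omit hl in
theorem odd_half_totient_iff : Odd (q ^ (l - 1) * ((q - 1) / 2)) ↔ q % 4 = 3 := by
  have := Nat.odd_iff.mp (hq.odd_of_ne_two hq2)
  rw [Nat.odd_mul, Nat.odd_iff (n := (q - 1) / 2)]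
  have h1 : Odd (q ^ (l - 1)) := (hq.odd_of_ne_two hq2).pow
  simp only [h1, true_and]
  lia

/-- A quadratic residue modulo `q` is not a primitive root modulo `q^l`. -/
theorem ordMod_ne_totient_of_jacobiSym_eq_one (h : jacobiSym a q = 1) :
    ordMod (q ^ l) a ≠ (q ^ l).totient := by
  have : Fact q.Prime := ⟨hq⟩
  have h1 : ordMod (q ^ l) a ∣ q ^ (l - 1) * ((q - 1) / 2) := by
    rw [ordMod_dvd_iff, mul_comm, pow_mul]
    have h2 : a ^ ((q - 1) / 2) ≡ 1 [MOD q] := by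
      rw [← ZMod.natCast_eq_natCast_iff]
      rw [← jacobiSym.legendreSym.to_jacobiSym] at h
      have h3 := legendreSym.eq_pow q a
      have := Nat.odd_iff.mp (hq.odd_of_ne_two hq2)
      rw [h, show q / 2 = (q - 1) / 2 by lia] at h3
      push_cast at h3 ⊢
      exact h3.symm
    rw [Nat.ModEq.comm, Nat.modEq_iff_dvd] at h2 ⊢
    obtain ⟨l, rfl⟩ := Nat.exists_eq_add_of_le' hl
    push_cast at h2 ⊢
    simpa using dvd_sub_pow_of_dvd_sub h2 l
  intro ho
  rw [totient_prime_pow_eq_two_mul hq hq2 hl] at ho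
  have hpos : 0 < q ^ (l - 1) * ((q - 1) / 2) :=
    Nat.mul_pos (Nat.pow_pos hq.pos) (by
      have := hq.two_le; have := Nat.odd_iff.mp (hq.odd_of_ne_two hq2); lia)
  have := Nat.le_of_dvd hpos h1
  lia

omit hq2 hq in
/-- An element of odd order modulo `q^l` is a quadratic residue modulo `q`. -/
theorem jacobiSym_eq_one_of_odd_ordMod (h : Odd (ordMod (q ^ l) a)) : jacobiSym a q = 1 := by
  have h1 : a ^ ordMod (q ^ l) a ≡ 1 [MOD q] :=
    (ordMod_dvd_iff.mp dvd_rfl).of_dvd (dvd_pow_self q (by lia))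
  have h2 : jacobiSym a q ^ ordMod (q ^ l) a = 1 := by
    rw [← jacobiSym.pow_left]
    exact_mod_cast jacobiSym_eq_one_of_modEq_one h1 dvd_rfl
  rcases jacobiSym.trichotomy a q with h3 | h3 | h3
  · rw [h3, zero_pow h.pos.ne'] at h2; simp at h2
  · exact h3
  · rw [h3, h.neg_one_pow] at h2; simp at h2

end PrimePowers

section Symbol

/-- Quadratic reciprocity, with the supplementary law at `2`. -/
theorem primeSym_eq_jacobiSym {d : ℤ} (hd : d % 4 = 1) (p : ℕ) [Fact p.Prime] :
    primeSym d p = jacobiSym p d.natAbs := by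
  have hodd : Odd d.natAbs := Int.natAbs_odd.mpr (Int.odd_iff.mpr (by lia))
  unfold primeSym
  split_ifs with h2
  · subst h2
    rw [Nat.cast_ofNat, jacobiSym.at_two hodd, ZMod.χ₈_int_eq_if_mod_eight,
      ZMod.χ₈_nat_eq_if_mod_eight]
    split_ifs <;> lia
  · rw [jacobiSym.legendreSym.to_jacobiSym,
      jacobiSym_eq_of_modFour_eq_one hd (Nat.Prime.odd_of_ne_two Fact.out h2)]

theorem primeSym_eq_neg_one_iff {d : ℤ} (hd : d % 4 = 1) (p : ℕ) [Fact p.Prime] :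
    primeSym d p = -1 ↔ IsInertAt d p := by
  unfold primeSym IsInertAt
  split_ifs with h2
  · rw [ZMod.χ₈_int_eq_if_mod_eight]
    split_ifs <;> lia
  · rfl

theorem primeSym_eq_one_or_neg_one {d : ℤ} (hd : d % 4 = 1) (p : ℕ) [Fact p.Prime]
    (h : ¬ (p : ℤ) ∣ d) : primeSym d p = 1 ∨ primeSym d p = -1 := by
  rw [primeSym_eq_jacobiSym hd]
  refine jacobiSym.eq_one_or_neg_one ?_
  rw [Int.gcd_eq_natAbs, Int.natAbs_natCast, Int.natAbs_natCast]
  exact (Nat.Prime.coprime_iff_not_dvd Fact.out).mpr fun h' => h (Int.natCast_dvd.mpr h')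

end Symbol

/-! ### Index one, and index two for even discriminants -/

section Arithmetic
variable {p n : ℕ} [hp : Fact p.Prime] (hpn : ¬ p ∣ n)

theorem legendreSym_trichotomy (p : ℕ) [Fact p.Prime] (a : ℤ) :
    legendreSym p a = 0 ∨ legendreSym p a = 1 ∨ legendreSym p a = -1 := by
  rw [jacobiSym.legendreSym.to_jacobiSym]; exact jacobiSym.trichotomy a p

include hpn in
theorem coprime_of_not_dvd : p.Coprime n := (Nat.Prime.coprime_iff_not_dvd hp.out).mpr hpn

include hpn in
/-- The case in which `K` and the `n`-th cyclotomic field are linearly disjoint: if `p` is not inert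
then `p` has to be a primitive root of `n`, and otherwise `p²` has to be one. -/
theorem ordMod_eq_totient_iff_of_linearly_disjoint (hn : 0 < n) (D : ℤ) :
    ordMod n (residueCard D p) = n.totient ↔
        ((p = 2 ∧ IsPrimitiveRootMod n p ∧ ¬ D ≡ 5 [ZMOD 8]) ∨
         (p ≠ 2 ∧ IsPrimitiveRootMod n p ∧ (legendreSym p D = 1 ∨ legendreSym p D = 0)) ∨
         ((n = 1 ∨ n = 2) ∧ p ≠ 2 ∧ legendreSym p D = -1) ∨
         (n = 1 ∧ p = 2 ∧ D ≡ 5 [ZMOD 8])) := by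
  have hcop := coprime_of_not_dvd hpn
  have h5 : D ≡ 5 [ZMOD 8] ↔ D % 8 = 5 := by unfold Int.ModEq; lia
  have htri := legendreSym_trichotomy p D
  have hsq := ordMod_sq_eq_totient_iff hcop hn
  have hprim : IsPrimitiveRootMod n p ↔ ordMod n p = n.totient := by
    exact and_iff_right hcop
  have h22 : ¬ (p = 2 ∧ n = 2) := by rintro ⟨rfl, rfl⟩; simp at hpn
  rw [h5, hprim]
  by_cases hI : IsInertAt D p
  · rw [residueCard_of_isInertAt hI, hsq]
    unfold IsInertAt at hI
    split_ifs at hI <;> lia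
  · rw [residueCard_of_not_isInertAt hI]
    unfold IsInertAt at hI
    split_ifs at hI <;> lia

theorem natAbs_eq_prime_of_dvd_prime_pow {d : ℤ} (hd : Squarefree d) {r k : ℕ} (hr : r.Prime)
    (h : d.natAbs ∣ r ^ k) (h1 : d.natAbs ≠ 1) : d.natAbs = r := by
  have := (Nat.dvd_prime hr).mp
    (dvd_of_squarefree_of_forall_prime (Int.squarefree_natAbs.mpr hd)
      fun q hq hqd => hq.dvd_of_dvd_pow (hqd.trans h))
  exact this.resolve_left h1

theorem natAbs_ne_one {d : ℤ} (h : d ≠ 1) (h' : d ≠ -1) : d.natAbs ≠ 1 := by lia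

theorem legendreSym_four_mul (hp2 : p ≠ 2) (d : ℤ) : legendreSym p (4 * d) = jacobiSym d p := by
  rw [jacobiSym.legendreSym.to_jacobiSym, jacobiSym.mul_left,
    jacobiSym.at_four (hp.out.odd_of_ne_two hp2), one_mul]

include hpn in
theorem ne_two_of_even (h : 2 ∣ n) : p ≠ 2 := by rintro rfl; exact hpn h

include hpn in
/-- The shape of `n` and `p` when `K = ℚ(√d)` with `d ≡ 2, 3 (mod 4)` lies in the `n`-th
cyclotomic field and `p` splits in `K`. -/
theorem shape_of_four_mul_dvd (hn : 0 < n) {d : ℤ} (hd : Squarefree d) (hd1 : d.natAbs ≠ 1)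
    (hdn : 4 * d ∣ (n : ℤ)) (hd4 : d % 4 = 2 ∨ d % 4 = 3)
    (hsym : jacobiSym d p = 1) (ho : 2 * ordMod n p = n.totient) :
    d.natAbs.Prime ∧ (∃ l : ℕ, 1 ≤ l ∧ n = 4 * d.natAbs ^ l) ∧ p % 4 = 3 := by
  have hcop := coprime_of_not_dvd hpn
  have hdn' : 4 * d.natAbs ∣ n := by
    have := Int.natAbs_dvd_natAbs.mpr hdn
    rwa [Int.natAbs_mul, Int.natAbs_natCast] at this
  have h4n : 4 ∣ n := dvd_of_mul_right_dvd hdn'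
  have hp2 : p ≠ 2 := ne_two_of_even hpn ((by norm_num : 2 ∣ 4).trans h4n)
  have hpodd := hp.out.odd_of_ne_two hp2
  have hpodd' := Nat.odd_iff.mp hpodd
  obtain ⟨k, m, hm, rfl⟩ := Nat.exists_eq_two_pow_mul_odd hn.ne'
  have hk : 2 ≤ k := by
    have := (Nat.Coprime.dvd_of_dvd_mul_right
      ((Nat.coprime_two_left.mpr hm).pow_left 2 : (2 ^ 2).Coprime m) h4n)
    exact (Nat.pow_dvd_pow_iff_le_right (by norm_num)).mp this
  by_cases hm1 : m = 1
  · subst hm1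
    rw [mul_one] at *
    have hd2 : d.natAbs = 2 :=
      natAbs_eq_prime_of_dvd_prime_pow hd Nat.prime_two (dvd_of_mul_left_dvd hdn') hd1
    rw [hd2] at hdn' ⊢
    have hk3 : 3 ≤ k := (Nat.pow_dvd_pow_iff_le_right (by norm_num : 1 < 2)).mp hdn'
    obtain ⟨k, rfl⟩ := Nat.exists_eq_add_of_le' hk3
    refine ⟨Nat.prime_two, ⟨k + 1, by lia, by ring⟩, ?_⟩
    by_contra hp3
    have hp8 : p % 8 = 1 := by
      by_contra hp8
      have hp5 : p % 8 = 5 := by lia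
      rcases (by lia : d = 2 ∨ d = -2) with rfl | rfl
      · rw [jacobiSym.at_two hpodd, ZMod.χ₈_nat_eq_if_mod_eight] at hsym
        simp [hp5, hpodd'] at hsym
      · rw [jacobiSym.at_neg_two hpodd, ZMod.χ₈'_nat_eq_if_mod_eight] at hsym
        simp [hp5, hpodd'] at hsym
    have h1 := Nat.le_of_dvd (by positivity) (ordMod_two_pow_dvd_of_one_mod_eight hp8 k)
    rw [(totient_two_pow (k + 2) : Nat.totient (2 ^ (k + 3)) = 2 ^ (k + 2))] at ho
    have : 2 ^ (k + 2) = 4 * 2 ^ k := by ring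
    have : 0 < 2 ^ k := by positivity
    lia
  · have hk2 : k = 2 := (le_two_of_two_mul_ordMod hm hm1 hcop ho).antisymm hk
    subst hk2
    have hd3 : d % 4 = 3 := by
      refine hd4.resolve_left fun h2 => ?_
      have h2d : 2 ∣ d.natAbs := by lia
      have h8 : 2 ^ 3 ∣ 2 ^ 2 * m := (mul_dvd_mul_left 4 h2d).trans hdn'
      have := Nat.Coprime.dvd_of_dvd_mul_right
        ((Nat.coprime_two_left.mpr hm).pow_left 3) h8
      norm_num at this
    have hdm : d.natAbs ∣ m := Nat.dvd_of_mul_dvd_mul_left (by norm_num) hdn'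
    have hcopm := hcop.coprime_dvd_right (dvd_mul_left m (2 ^ 2))
    have hkey := (two_mul_ordMod_mul_iff ((Nat.coprime_two_left.mpr hm).pow_left 2) hcop hn).mp ho
    have hord4 : p % 4 = 1 ∨ p % 4 = 3 := by lia
    have h44 : (2 ^ 2 : ℕ) = 4 := rfl
    rw [h44, totient_four] at hkey
    obtain ⟨q, hq, hqd⟩ := Nat.exists_prime_and_dvd hd1
    have hq2 : q ≠ 2 := by rintro rfl; lia
    have hprimepow : ∃ l, 1 ≤ l ∧ m = q ^ l := by
      refine exists_eq_prime_pow hm hm1 hcopm ?_ hq (hqd.trans hdm)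
      rcases hkey with ⟨-, h, -⟩ | ⟨h1, h, h3⟩ | ⟨-, h, -⟩
      · exact Or.inl h
      · rw [h1] at h3
        exact Or.inr ⟨h, Nat.coprime_two_left.mp h3⟩
      · exact Or.inl h
    obtain ⟨l, hl, rfl⟩ := hprimepow
    have hdq : d.natAbs = q := natAbs_eq_prime_of_dvd_prime_pow hd hq hdm hd1
    refine ⟨hdq ▸ hq, ⟨l, hl, by rw [hdq]; rfl⟩, ?_⟩
    refine hord4.resolve_left fun hp1 => ?_
    rw [ordMod_four_of_one hp1] at hkey
    have hprim : ordMod (q ^ l) p = (q ^ l).totient := by lia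
    refine ordMod_ne_totient_of_jacobiSym_eq_one hq hq2 hl ?_ hprim
    rw [← neg_neg d, jacobiSym.neg _ hpodd, ZMod.χ₄_nat_one_mod_four hp1, one_mul,
      jacobiSym_eq_of_modFour_eq_one (by lia) hpodd, Int.natAbs_neg, hdq] at hsym
    exact hsym

include hpn in
/-- The case `K = ℚ(√d)` with `d ≡ 2, 3 (mod 4)`, `d ≠ -1`, inside the `n`-th cyclotomic field. The
prime `p` cannot be inert, because then `n` would be `4`, and it does not ramify as `p ∤ n`. -/
theorem two_mul_ordMod_eq_totient_iff_of_four_mul_dvd (hn : 0 < n) {d : ℤ} (hd : Squarefree d)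
    (hd1 : d ≠ 1) (hdm1 : d ≠ -1)
    (hdn : 4 * d ∣ (n : ℤ)) (hd4 : d % 4 = 2 ∨ d % 4 = 3) :
    2 * ordMod n (residueCard (4 * d) p) = n.totient ↔
      (d.natAbs.Prime ∧ (∃ ℓ : ℕ, 1 ≤ ℓ ∧ n = 4 * d.natAbs ^ ℓ) ∧
          p ≡ 3 [MOD 4] ∧ legendreSym p (4 * d) = 1 ∧ 2 * ordMod n p = n.totient) := by
  have hcop := coprime_of_not_dvd hpn
  have h4n : 4 ∣ n := by exact_mod_cast dvd_of_mul_right_dvd hdn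
  have hp2 : p ≠ 2 := ne_two_of_even hpn ((by norm_num : 2 ∣ 4).trans h4n)
  have hinert : IsInertAt (4 * d) p ↔ legendreSym p (4 * d) = -1 := by
    rw [IsInertAt, if_neg hp2]
  have hd1' := natAbs_ne_one hd1 hdm1
  have hmod : p ≡ 3 [MOD 4] ↔ p % 4 = 3 := Iff.rfl
  rw [hmod]
  by_cases h1 : legendreSym p (4 * d) = -1
  · rw [h1, residueCard_of_isInertAt (hinert.mpr h1)]
    refine iff_of_false (fun ho => ?_) (by simp)
    have h4 := eq_four_of_two_mul_ordMod_sq hcop hn h4n ho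
    rw [h4] at hdn
    have := Int.le_of_dvd (by norm_num) (Int.natAbs_dvd.mpr hdn)
    have h0 := hd.ne_zero
    lia
  · rw [residueCard_of_not_isInertAt (mt hinert.mp h1)]
    constructor
    · intro ho
      have hsym : legendreSym p (4 * d) = 1 := by
        rcases legendreSym_trichotomy p (4 * d) with h | h | h
        · exfalso
          rw [legendreSym.eq_zero_iff, ZMod.intCast_zmod_eq_zero_iff_dvd] at h
          exact hpn (by exact_mod_cast h.trans hdn)
        · exact h
        · exact absurd h h1
      obtain ⟨h2, h3, h4⟩ := shape_of_four_mul_dvd hpn hn hd hd1' hdn hd4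
        (by rw [← legendreSym_four_mul hp2, hsym]) ho
      exact ⟨h2, h3, h4, hsym, ho⟩
    · exact fun h => h.2.2.2.2

include hpn in
/-- The case `K = ℚ(i)`, of discriminant `-4`, inside the `n`-th cyclotomic field. If `p` is inert,
that is, `p ≡ 3 (mod 4)`, then both sides force `n = 4`. -/
theorem two_mul_ordMod_eq_totient_iff_of_four_dvd (hn : 0 < n) (h4n : 4 ∣ n) :
    2 * ordMod n (residueCard (-4) p) = n.totient ↔
       ∃ k n₁ : ℕ, Odd n₁ ∧ n = 2 ^ (k + 2) * n₁ ∧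
          IsPrimitiveRootMod n₁ p ∧
          ordMod (2 ^ (k + 2)) p = 2 ^ k * ordMod 4 p ∧
          Nat.gcd (ordMod n₁ p) (ordMod (2 ^ (k + 2)) p) = 1 := by
  have hcop := coprime_of_not_dvd hpn
  have hp2 : p ≠ 2 := ne_two_of_even hpn ((by norm_num : 2 ∣ 4).trans h4n)
  have hpodd := hp.out.odd_of_ne_two hp2
  have hpodd' := Nat.odd_iff.mp hpodd
  have hleg : legendreSym p (-4) = ZMod.χ₄ p := by
    rw [show (-4 : ℤ) = 4 * -1 by ring, legendreSym_four_mul hp2, jacobiSym.at_neg_one hpodd]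
  have hinert : IsInertAt (-4) p ↔ ZMod.χ₄ p = -1 := by
    rw [IsInertAt, if_neg hp2, hleg]
  rcases Nat.odd_mod_four_iff.mp hpodd' with h1 | h3
  · rw [ZMod.χ₄_nat_one_mod_four h1] at hinert
    rw [residueCard_of_not_isInertAt (mt hinert.mp (by norm_num))]
    have htriple : ∀ k n₁ : ℕ, Odd n₁ → n = 2 ^ (k + 2) * n₁ → (2 * ordMod n p = n.totient ↔
        (IsPrimitiveRootMod n₁ p ∧ ordMod (2 ^ (k + 2)) p = 2 ^ k * ordMod 4 p ∧
          Nat.gcd (ordMod n₁ p) (ordMod (2 ^ (k + 2)) p) = 1)) := by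
      rintro k n₁ hn₁ rfl
      have hle := Nat.le_of_dvd (by positivity) (ordMod_two_pow_dvd_of_one_mod_four h1 k)
      rw [two_mul_ordMod_mul_iff ((Nat.coprime_two_left.mpr hn₁).pow_left _) hcop hn,
        ordMod_four_of_one h1, (totient_two_pow (k + 1) : Nat.totient (2 ^ (k + 2)) = 2 ^ (k + 1)),
        IsPrimitiveRootMod, Nat.gcd_comm (ordMod n₁ p)]
      have hcop1 : p.Coprime n₁ := hcop.coprime_dvd_right (dvd_mul_left _ _)
      have h2 : 2 ^ (k + 1) = 2 * 2 ^ k := by ring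
      have h0 : 0 < 2 ^ k := by positivity
      simp only [mul_one]
      lia
    constructor
    · intro ho
      obtain ⟨k, n₁, hn₁, hnk⟩ := Nat.exists_eq_two_pow_mul_odd hn.ne'
      have hk : 2 ≤ k := by
        have := (Nat.Coprime.dvd_of_dvd_mul_right
          ((Nat.coprime_two_left.mpr hn₁).pow_left 2 : (2 ^ 2).Coprime n₁) (hnk ▸ h4n))
        exact (Nat.pow_dvd_pow_iff_le_right (by norm_num)).mp this
      obtain ⟨k, rfl⟩ := Nat.exists_eq_add_of_le' hk
      exact ⟨k, n₁, hn₁, hnk, (htriple k n₁ hn₁ hnk).mp ho⟩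
    · rintro ⟨k, n₁, hn₁, hnk, h⟩
      exact (htriple k n₁ hn₁ hnk).mpr h
  · rw [residueCard_of_isInertAt (hinert.mpr (ZMod.χ₄_nat_three_mod_four h3))]
    constructor
    · intro ho
      have := eq_four_of_two_mul_ordMod_sq hcop hn h4n ho
      refine ⟨0, 1, odd_one, this, ⟨Nat.coprime_one_right p, ?_⟩, by simp, ?_⟩
      · rw [ordMod_one, Nat.totient_one]
      · rw [ordMod_one, Nat.gcd_one_left]
    · rintro ⟨k, n₁, hn₁, rfl, ⟨-, h5⟩, h6, h7⟩
      rw [ordMod_four_of_three h3] at h6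
      have hk : k = 0 := by
        by_contra hk
        obtain ⟨k, rfl⟩ := Nat.exists_eq_add_of_le' (Nat.one_le_iff_ne_zero.mpr hk)
        have := Nat.le_of_dvd (by positivity) (ordMod_two_pow_dvd hpodd k)
        rw [show k + 1 + 2 = k + 3 by ring] at h6
        have : 0 < 2 ^ (k + 1) := by positivity
        lia
      subst hk
      have h8 : n₁ = 1 := by
        by_contra hne
        have hn2 : 2 < n₁ := by have := Nat.odd_iff.mp hn₁; lia
        have := Nat.dvd_gcd (h5 ▸ even_totient hn2) (by rw [h6]; norm_num :
          2 ∣ ordMod (2 ^ (0 + 2)) p)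
        rw [h7] at this
        lia
      subst h8
      have h9 : 2 * ordMod 4 (p ^ 2) = 2 := by
        rw [two_mul_ordMod_sq_of_even (by rw [ordMod_four_of_three h3]), ordMod_four_of_three h3]
      simpa [totient_four] using h9
end Arithmetic

/-! ### Index two for odd discriminants -/

section Arithmetic
variable {p n : ℕ} [hp : Fact p.Prime] (hpn : ¬ p ∣ n) (hn : 0 < n) {d : ℤ} (hd : Squarefree d)
  (hd1 : d ≠ 1) (hd4 : d % 4 = 1) (hdn : d ∣ (n : ℤ))

include hd1 hd4 in
theorem exists_odd_prime_dvd_natAbs : d.natAbs ≠ 1 ∧ Odd d.natAbs ∧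
    ∃ q, q.Prime ∧ q ≠ 2 ∧ q ∣ d.natAbs := by
  have h1 : d.natAbs ≠ 1 := by lia
  have hodd : Odd d.natAbs := Nat.odd_iff.mpr (by lia)
  obtain ⟨q, hq, hqd⟩ := Nat.exists_prime_and_dvd h1
  exact ⟨h1, hodd, q, hq, by rintro rfl; lia, hqd⟩

include hpn hn hd hd1 hd4 hdn in
/-- The shape of `n` when `p` is inert in `K`, so that `p²` has index two modulo `n`. -/
theorem shape_of_two_mul_ordMod_sq (ho : 2 * ordMod n (p ^ 2) = n.totient) :
    d.natAbs.Prime ∧ (∃ l : ℕ, 1 ≤ l ∧ (n = d.natAbs ^ l ∨ n = 2 * d.natAbs ^ l)) ∧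
      (ordMod n p = n.totient ∨ (2 * ordMod n p = n.totient ∧ d < 0)) := by
  have hcop := coprime_of_not_dvd hpn
  obtain ⟨hd1', hodd, q, hq, hq2, hqd⟩ := exists_odd_prime_dvd_natAbs hd1 hd4
  have hdn' : d.natAbs ∣ n := by simpa using Int.natAbs_dvd_natAbs.mpr hdn
  obtain ⟨l, m, hl, hlm, rfl⟩ := exists_eq_prime_pow_mul hq hn.ne' (hqd.trans hdn')
  have hm := eq_one_or_two_of_two_mul_ordMod_sq hlm hcop hn ho (two_lt_prime_pow hq hq2 hl)
  have hdm : d.natAbs.Coprime m := by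
    rcases hm with rfl | rfl
    · exact Nat.coprime_one_right _
    · exact Nat.coprime_two_right.mpr hodd
  have hdq : d.natAbs = q :=
    natAbs_eq_prime_of_dvd_prime_pow hd hq (hdm.dvd_of_dvd_mul_right hdn') hd1'
  have hφ : (q ^ l * m).totient = 2 * (q ^ (l - 1) * ((q - 1) / 2)) := by
    rw [← totient_prime_pow_eq_two_mul hq hq2 hl, Nat.totient_mul hlm]
    rcases hm with rfl | rfl <;> simp
  refine ⟨hdq ▸ hq, ⟨l, hl, ?_⟩, ?_⟩
  · rw [hdq]
    rcases hm with rfl | rfl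
    · left; rw [mul_one]
    · right; rw [mul_comm]
  · rcases Nat.even_or_odd (ordMod (q ^ l * m) p) with he | ho'
    · left
      rw [← two_mul_ordMod_sq_of_even he.two_dvd, ho]
    · right
      rw [ordMod_sq_of_odd ho'] at ho
      refine ⟨ho, ?_⟩
      have h1 : ordMod (q ^ l * m) p = q ^ (l - 1) * ((q - 1) / 2) := by lia
      rw [h1, odd_half_totient_iff hq hq2] at ho'
      lia

include hpn hn hd hd1 hd4 hdn in
/-- The shape of `n` when `p` splits in `K`, so that `p` has index two modulo `n`: at most two odd
prime powers and a bounded power of `2` can occur, and if `|d| = q` is a prime, then `(d/p) = 1`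
excludes that `p` is a primitive root modulo a power of `q`. -/
theorem shape_of_two_mul_ordMod (hsym : primeSym d p = 1) (ho : 2 * ordMod n p = n.totient) :
    (d.natAbs.Prime ∧ ∃ ℓ : ℕ, 1 ≤ ℓ ∧ (n = d.natAbs ^ ℓ ∨ n = 2 * d.natAbs ^ ℓ)) ∨
    (∃ q ℓ : ℕ, d.natAbs = q ∧ q.Prime ∧ 1 ≤ ℓ ∧ n = 4 * q ^ ℓ ∧ q ≡ 3 [MOD 4] ∧
      p ≡ 3 [MOD 4] ∧ ordMod (q ^ ℓ) p = q ^ (ℓ - 1) * ((q - 1) / 2)) ∨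
    (∃ q₁ q₂ ℓ₁ ℓ₂ : ℕ, d.natAbs = q₁ ∧ q₁.Prime ∧ 1 ≤ ℓ₁ ∧ 1 ≤ ℓ₂ ∧
      (n = q₁ ^ ℓ₁ * q₂ ^ ℓ₂ ∨ n = 2 * (q₁ ^ ℓ₁ * q₂ ^ ℓ₂)) ∧
      q₁ ≡ 3 [MOD 4] ∧ q₂.Prime ∧ Odd q₂ ∧ q₂ ≠ q₁ ∧ IsPrimitiveRootMod (q₂ ^ ℓ₂) p ∧
      ordMod (q₁ ^ ℓ₁) p = q₁ ^ (ℓ₁ - 1) * ((q₁ - 1) / 2) ∧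
      Nat.gcd (q₁ ^ (ℓ₁ - 1) * ((q₁ - 1) / 2)) (q₂ ^ (ℓ₂ - 1) * (q₂ - 1)) = 1) ∨
    (∃ q₁ q₂ ℓ₁ ℓ₂ : ℕ, d.natAbs = q₁ * q₂ ∧ q₁.Prime ∧ q₂.Prime ∧ q₁ ≠ q₂ ∧
      1 ≤ ℓ₁ ∧ 1 ≤ ℓ₂ ∧ (n = q₁ ^ ℓ₁ * q₂ ^ ℓ₂ ∨ n = 2 * (q₁ ^ ℓ₁ * q₂ ^ ℓ₂)) ∧
      IsPrimitiveRootMod (q₁ ^ ℓ₁) p ∧ IsPrimitiveRootMod (q₂ ^ ℓ₂) p ∧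
      Nat.gcd (q₁ ^ (ℓ₁ - 1) * ((q₁ - 1) / 2)) (q₂ ^ (ℓ₂ - 1) * ((q₂ - 1) / 2)) = 1) := by
  have hcop := coprime_of_not_dvd hpn
  obtain ⟨hd1', hodd, q, hq, hq2, hqd⟩ := exists_odd_prime_dvd_natAbs hd1 hd4
  have hdn' : d.natAbs ∣ n := by simpa using Int.natAbs_dvd_natAbs.mpr hdn
  rw [primeSym_eq_jacobiSym hd4] at hsym
  obtain ⟨k, m, hm, rfl⟩ := Nat.exists_eq_two_pow_mul_odd hn.ne'
  have hdm : d.natAbs ∣ m :=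
    Nat.Coprime.dvd_of_dvd_mul_left ((Nat.coprime_two_right.mpr hodd).pow_right k) hdn'
  have hm1 : m ≠ 1 := by rintro rfl; exact hd1' (Nat.dvd_one.mp hdm)
  have hm0 : m ≠ 0 := by rintro rfl; simp at hm
  have hcopm := hcop.coprime_dvd_right (dvd_mul_left m (2 ^ k))
  have hk := le_two_of_two_mul_ordMod hm hm1 hcop ho
  rcases (by lia : k = 2 ∨ k ≤ 1) with rfl | hk1
  · -- `4 ∣ n`
    right; left
    have hpodd : Odd p :=
      hp.out.odd_of_ne_two (ne_two_of_even hpn ((by norm_num : 2 ∣ 2 ^ 2).mul_right m))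
    have hkey := (two_mul_ordMod_mul_iff ((Nat.coprime_two_left.mpr hm).pow_left 2) hcop hn).mp ho
    have h44 : (2 ^ 2 : ℕ) = 4 := rfl
    rw [h44, totient_four] at hkey
    obtain ⟨l, hl, rfl⟩ : ∃ l, 1 ≤ l ∧ m = q ^ l := by
      refine exists_eq_prime_pow hm hm1 hcopm ?_ hq (hqd.trans hdm)
      rcases hkey with ⟨-, h, -⟩ | ⟨h1, h, h3⟩ | ⟨-, h, -⟩
      · exact Or.inl h
      · rw [h1] at h3
        exact Or.inr ⟨h, Nat.coprime_two_left.mp h3⟩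
      · exact Or.inl h
    have hdq : d.natAbs = q := natAbs_eq_prime_of_dvd_prime_pow hd hq hdm hd1'
    rw [hdq] at hsym
    have hne := ordMod_ne_totient_of_jacobiSym_eq_one hq hq2 hl hsym
    obtain ⟨h1, h2, h3⟩ : ordMod 4 p = 2 ∧ 2 * ordMod (q ^ l) p = (q ^ l).totient ∧
        (ordMod 4 p).gcd (ordMod (q ^ l) p) = 1 := by
      rcases hkey with ⟨-, h, -⟩ | h | ⟨-, h, -⟩
      · exact absurd h hne
      · exact h
      · exact absurd h hne
    rw [totient_prime_pow_eq_two_mul hq hq2 hl] at h2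
    rw [h1] at h3
    have h4 : ordMod (q ^ l) p = q ^ (l - 1) * ((q - 1) / 2) := by lia
    have h5 : Odd (ordMod (q ^ l) p) := Nat.coprime_two_left.mp h3
    rw [h4, odd_half_totient_iff hq hq2] at h5
    refine ⟨q, l, hdq, hq, hl, rfl, h5, ?_, h4⟩
    rcases Nat.odd_mod_four_iff.mp (Nat.odd_iff.mp hpodd) with h | h
    · rw [ordMod_four_of_one h] at h1; lia
    · exact h
  · -- `n = m` or `n = 2m`
    have hnm : 2 ^ k * m = m ∨ 2 ^ k * m = 2 * m := by
      rcases (by lia : k = 0 ∨ k = 1) with rfl | rfl <;> simp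
    have hom : 2 * ordMod m p = m.totient := by
      rcases hnm with h | h
      · rwa [h] at ho
      · rw [h] at ho hcop
        rwa [ordMod_two_mul hcop hm, totient_two_mul hm] at ho
    obtain ⟨l, m', hl, hlm, hmeq⟩ := exists_eq_prime_pow_mul hq hm0 (hqd.trans hdm)
    by_cases hm1' : m' = 1
    · left
      rw [hm1', mul_one] at hmeq
      rw [hmeq] at hdm
      have hdq : d.natAbs = q := natAbs_eq_prime_of_dvd_prime_pow hd hq hdm hd1'
      exact ⟨hdq ▸ hq, l, hl, by rw [hdq, ← hmeq]; exact hnm⟩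
    · right; right
      rw [hmeq] at hom hm hcopm hdm hm0
      have hm' : Odd m' := (Nat.odd_mul.mp hm).2
      have hkey := (two_mul_ordMod_mul_iff hlm hcopm (Nat.pos_of_ne_zero hm0)).mp hom
      have hcop1 := hcopm.coprime_dvd_right (dvd_mul_right (q ^ l) m')
      have hcop2 := hcopm.coprime_dvd_right (dvd_mul_left m' (q ^ l))
      obtain ⟨q₂, hq₂, hq₂m⟩ := Nat.exists_prime_and_dvd hm1'
      have hq₂odd : Odd q₂ := hm'.of_dvd_nat hq₂m
      have hq₂2 : q₂ ≠ 2 := by rintro rfl; exact absurd hq₂odd (by decide)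
      have heven := even_totient (two_lt_prime_pow hq hq2 hl)
      obtain ⟨l₂, hl₂, rfl⟩ : ∃ l, 1 ≤ l ∧ m' = q₂ ^ l := by
        refine exists_eq_prime_pow hm' hm1' hcop2 ?_ hq₂ hq₂m
        rcases hkey with ⟨-, h, -⟩ | ⟨h1, h, h3⟩ | ⟨-, h, -⟩
        · exact Or.inl h
        · refine Or.inr ⟨h, ?_⟩
          rw [h1] at h3
          exact Nat.coprime_two_left.mp (Nat.Coprime.coprime_dvd_left heven h3)
        · exact Or.inl h
      have hqq : q ≠ q₂ := by
        rintro rfl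
        have := (hlm.coprime_dvd_left (dvd_pow_self q (by lia))).coprime_dvd_right
          (dvd_pow_self q (by lia))
        rw [Nat.coprime_self] at this
        exact hq.ne_one this
      have heven₂ := even_totient (two_lt_prime_pow hq₂ hq₂2 hl₂)
      have hnm' : 2 ^ k * m = q ^ l * q₂ ^ l₂ ∨ 2 ^ k * m = 2 * (q ^ l * q₂ ^ l₂) := by
        rw [← hmeq]; exact hnm
      have hφ₁ := totient_prime_pow_eq_two_mul hq hq2 hl
      have hφ₂ := totient_prime_pow_eq_two_mul hq₂ hq₂2 hl₂
      by_cases hq₂d : q₂ ∣ d.natAbs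
      · -- both primes divide `d`
        right
        have hdqq : d.natAbs = q * q₂ := by
          refine Nat.dvd_antisymm (dvd_of_squarefree_of_forall_prime
            (Int.squarefree_natAbs.mpr hd) fun r hr hrd => ?_)
            (((Nat.coprime_primes hq hq₂).mpr hqq).mul_dvd_of_dvd_of_dvd hqd hq₂d)
          rcases (Nat.Prime.dvd_mul hr).mp (hrd.trans hdm) with h | h
          · exact (hr.dvd_of_dvd_pow h).mul_right _
          · exact (hr.dvd_of_dvd_pow h).mul_left _
        rw [hdqq, jacobiSym.mul_right' _ hq.ne_zero hq₂.ne_zero] at hsym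
        -- if `p` had odd order modulo one of the primes, it would be a residue modulo both
        obtain ⟨h1, h2, h3⟩ : ordMod (q ^ l) p = (q ^ l).totient ∧
            ordMod (q₂ ^ l₂) p = (q₂ ^ l₂).totient ∧
            (ordMod (q ^ l) p).gcd (ordMod (q₂ ^ l₂) p) = 2 := by
          rcases hkey with ⟨h1, h2, h3⟩ | ⟨h1, h2, h3⟩ | h
          · exfalso
            have hodd1 : Odd (ordMod (q ^ l) p) := Nat.coprime_two_right.mp
              (Nat.Coprime.coprime_dvd_right (h2 ▸ heven₂) h3)
            rw [jacobiSym_eq_one_of_odd_ordMod hl hodd1, one_mul] at hsym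
            exact ordMod_ne_totient_of_jacobiSym_eq_one hq₂ hq₂2 hl₂ hsym h2
          · exfalso
            have hodd2 : Odd (ordMod (q₂ ^ l₂) p) := Nat.coprime_two_left.mp
              (Nat.Coprime.coprime_dvd_left (h1 ▸ heven) h3)
            rw [jacobiSym_eq_one_of_odd_ordMod hl₂ hodd2, mul_one] at hsym
            exact ordMod_ne_totient_of_jacobiSym_eq_one hq hq2 hl hsym h1
          · exact h
        refine ⟨q, q₂, l, l₂, hdqq, hq, hq₂, hqq, hl, hl₂, hnm', ⟨hcop1, h1⟩, ⟨hcop2, h2⟩, ?_⟩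
        rw [h1, h2, hφ₁, hφ₂, Nat.gcd_mul_left] at h3
        lia
      · -- only one prime divides `d`
        left
        have hdq : d.natAbs = q := by
          refine natAbs_eq_prime_of_dvd_prime_pow hd hq
            (Nat.Coprime.dvd_of_dvd_mul_right ?_ hdm) hd1'
          exact (((hq₂.coprime_iff_not_dvd).mpr hq₂d).symm).pow_right l₂
        rw [hdq] at hsym
        have hne := ordMod_ne_totient_of_jacobiSym_eq_one hq hq2 hl hsym
        obtain ⟨h1, h2, h3⟩ : 2 * ordMod (q ^ l) p = (q ^ l).totient ∧
            ordMod (q₂ ^ l₂) p = (q₂ ^ l₂).totient ∧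
            (ordMod (q ^ l) p).gcd (ordMod (q₂ ^ l₂) p) = 1 := by
          rcases hkey with h | ⟨h, -⟩ | ⟨h, -⟩
          · exact h
          · exact absurd h hne
          · exact absurd h hne
        have h4 : ordMod (q ^ l) p = q ^ (l - 1) * ((q - 1) / 2) := by lia
        have h5 : Odd (ordMod (q ^ l) p) := Nat.coprime_two_right.mp
          (Nat.Coprime.coprime_dvd_right (h2 ▸ heven₂) h3)
        rw [h4, h2, totient_prime_pow_eq hq₂ hl₂] at h3
        rw [h4, odd_half_totient_iff hq hq2] at h5
        exact ⟨q, q₂, l, l₂, hdq, hq, hl, hl₂, hnm', h5, hq₂, hq₂odd, hqq.symm,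
          ⟨hcop2, h2⟩, h4, h3⟩

include hpn hn hd hd1 hd4 hdn in
/-- The case `K = ℚ(√d)` with `d ≡ 1 (mod 4)` inside the `n`-th cyclotomic field, where `p` is
either split or inert. -/
theorem two_mul_ordMod_eq_totient_iff_of_dvd :
    2 * ordMod n (residueCard d p) = n.totient ↔
        ( (d.natAbs.Prime ∧
            (∃ ℓ : ℕ, 1 ≤ ℓ ∧ (n = d.natAbs ^ ℓ ∨ n = 2 * d.natAbs ^ ℓ)) ∧
            ((ordMod n p : ℚ) = 2 * (n.totient : ℚ) / (3 + (primeSym d p : ℚ)) ∨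
              (2 * ordMod n p = n.totient ∧ primeSym d p = -1 ∧ d < 0))) ∨
         (∃ q ℓ : ℕ, d.natAbs = q ∧ q.Prime ∧ 1 ≤ ℓ ∧ n = 4 * q ^ ℓ ∧ q ≡ 3 [MOD 4] ∧
            primeSym d p = 1 ∧ p ≡ 3 [MOD 4] ∧
            ordMod (q ^ ℓ) p = q ^ (ℓ - 1) * ((q - 1) / 2)) ∨
         (∃ q₁ q₂ ℓ₁ ℓ₂ : ℕ, d.natAbs = q₁ ∧ q₁.Prime ∧ 1 ≤ ℓ₁ ∧ 1 ≤ ℓ₂ ∧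
            (n = q₁ ^ ℓ₁ * q₂ ^ ℓ₂ ∨ n = 2 * (q₁ ^ ℓ₁ * q₂ ^ ℓ₂)) ∧
            q₁ ≡ 3 [MOD 4] ∧ q₂.Prime ∧ Odd q₂ ∧ q₂ ≠ q₁ ∧
            primeSym d p = 1 ∧ IsPrimitiveRootMod (q₂ ^ ℓ₂) p ∧
            ordMod (q₁ ^ ℓ₁) p = q₁ ^ (ℓ₁ - 1) * ((q₁ - 1) / 2) ∧
            Nat.gcd (q₁ ^ (ℓ₁ - 1) * ((q₁ - 1) / 2)) (q₂ ^ (ℓ₂ - 1) * (q₂ - 1)) = 1) ∨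
         (∃ q₁ q₂ ℓ₁ ℓ₂ : ℕ, d.natAbs = q₁ * q₂ ∧ q₁.Prime ∧ q₂.Prime ∧ q₁ ≠ q₂ ∧
            1 ≤ ℓ₁ ∧ 1 ≤ ℓ₂ ∧
            (n = q₁ ^ ℓ₁ * q₂ ^ ℓ₂ ∨ n = 2 * (q₁ ^ ℓ₁ * q₂ ^ ℓ₂)) ∧
            primeSym d p = 1 ∧
            IsPrimitiveRootMod (q₁ ^ ℓ₁) p ∧ IsPrimitiveRootMod (q₂ ^ ℓ₂) p ∧
            Nat.gcd (q₁ ^ (ℓ₁ - 1) * ((q₁ - 1) / 2))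
              (q₂ ^ (ℓ₂ - 1) * ((q₂ - 1) / 2)) = 1)) := by
  have hcop := coprime_of_not_dvd hpn
  obtain ⟨hd1', hodd, -⟩ := exists_odd_prime_dvd_natAbs hd1 hd4
  have hpd : ¬ (p : ℤ) ∣ d := fun h => hpn (by exact_mod_cast h.trans hdn)
  have hinert := primeSym_eq_neg_one_iff hd4 p
  have hn1 : n = 1 ∨ n = 2 → False := by
    have hdn' : d.natAbs ∣ n := by simpa using Int.natAbs_dvd_natAbs.mpr hdn
    have := Nat.le_of_dvd hn hdn'
    have := Nat.odd_iff.mp hodd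
    have := Int.natAbs_ne_zero.mpr hd.ne_zero
    lia
  -- an odd or twice odd modulus has the same invariants as its odd part
  have hred : ∀ m, Odd m → (n = m ∨ n = 2 * m) → (2 * ordMod m p = m.totient ↔
      2 * ordMod n p = n.totient) ∧ p.Coprime m := by
    rintro m hm (rfl | rfl)
    · exact ⟨Iff.rfl, hcop⟩
    · rw [ordMod_two_mul hcop hm, totient_two_mul hm]
      exact ⟨Iff.rfl, hcop.coprime_dvd_right (dvd_mul_left _ _)⟩
  rcases primeSym_eq_one_or_neg_one hd4 p hpd with hs | hs
  · -- `p` splits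
    rw [residueCard_of_not_isInertAt (fun h => by rw [hinert.mpr h] at hs; norm_num at hs), hs]
    have hq : (ordMod n p : ℚ) = 2 * (n.totient : ℚ) / (3 + ((1 : ℤ) : ℚ)) ↔
        2 * ordMod n p = n.totient := by
      rw [Int.cast_one, eq_div_iff (by norm_num)]
      constructor
      · intro h
        have : (2 * ordMod n p : ℚ) = n.totient := by linarith
        exact_mod_cast this
      · intro h
        have : (2 * ordMod n p : ℚ) = n.totient := by exact_mod_cast h
        linarith
    rw [hq]
    constructor
    · intro ho
      rcases shape_of_two_mul_ordMod hpn hn hd hd1 hd4 hdn hs ho with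
        ⟨h1, h2⟩ | ⟨q, l, h1, h2, h3, h4, h5, h6⟩ |
        ⟨q₁, q₂, l₁, l₂, h1, h2, h3, h4, h5, h6, h7, h8, h9, h10⟩ |
        ⟨q₁, q₂, l₁, l₂, h1, h2, h3, h4, h5, h6, h7, h8⟩
      · exact Or.inl ⟨h1, h2, Or.inl ho⟩
      · exact Or.inr (Or.inl ⟨q, l, h1, h2, h3, h4, h5, rfl, h6⟩)
      · exact Or.inr (Or.inr (Or.inl
          ⟨q₁, q₂, l₁, l₂, h1, h2, h3, h4, h5, h6, h7, h8, h9, rfl, h10⟩))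
      · exact Or.inr (Or.inr (Or.inr ⟨q₁, q₂, l₁, l₂, h1, h2, h3, h4, h5, h6, h7, rfl, h8⟩))
    · rintro (⟨-, -, h | h⟩ | ⟨q, l, h1, h2, h3, h4, h5, -, h6, h7⟩ |
        ⟨q₁, q₂, l₁, l₂, h1, h2, h3, h4, h5, h6, h7, h8, h9, -, h10, h11, h12⟩ |
        ⟨q₁, q₂, l₁, l₂, h1, h2, h3, h4, h5, h6, h7, -, h8, h9, h10⟩)
      · exact h
      · exact h.1
      · have hqodd : Odd q := h1 ▸ hodd
        have hq2 : q ≠ 2 := by rintro rfl; exact absurd hqodd (by decide)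
        have h4q : Nat.Coprime 4 (q ^ l) := (Nat.coprime_two_left.mpr hqodd.pow).pow_left 2
        rw [h4] at hcop hn ⊢
        rw [two_mul_ordMod_mul_iff h4q hcop hn]
        right; left
        have h8 : Odd (ordMod (q ^ l) p) := by
          rw [h7, odd_half_totient_iff h2 hq2]; exact h5
        refine ⟨by rw [ordMod_four_of_three h6, totient_four], ?_, ?_⟩
        · rw [h7, totient_prime_pow_eq_two_mul h2 hq2 h3]
        · rw [ordMod_four_of_three h6]
          exact Nat.coprime_two_left.mpr h8
      · have hqodd : Odd q₁ := h1 ▸ hodd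
        have hq2 : q₁ ≠ 2 := by rintro rfl; exact absurd hqodd (by decide)
        have h12' : (q₁ ^ l₁).Coprime (q₂ ^ l₂) :=
          Nat.Coprime.pow _ _ ((Nat.coprime_primes h2 h7).mpr h9.symm)
        have hpos : 0 < q₁ ^ l₁ * q₂ ^ l₂ := Nat.mul_pos (Nat.pow_pos h2.pos) (Nat.pow_pos h7.pos)
        obtain ⟨hr, hcop'⟩ := hred _ (hqodd.pow.mul h8.pow) h5
        rw [← hr, two_mul_ordMod_mul_iff h12' hcop' hpos]
        left
        refine ⟨?_, h10.2, ?_⟩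
        · rw [h11, totient_prime_pow_eq_two_mul h2 hq2 h3]
        · rw [h11, h10.2, totient_prime_pow_eq h7 h4, h12]
      · rw [h1] at hodd
        have ho1 := (Nat.odd_mul.mp hodd).1
        have ho2 := (Nat.odd_mul.mp hodd).2
        have hq1 : q₁ ≠ 2 := by rintro rfl; exact absurd ho1 (by decide)
        have hq2 : q₂ ≠ 2 := by rintro rfl; exact absurd ho2 (by decide)
        have h12' : (q₁ ^ l₁).Coprime (q₂ ^ l₂) :=
          Nat.Coprime.pow _ _ ((Nat.coprime_primes h2 h3).mpr h4)
        have hpos : 0 < q₁ ^ l₁ * q₂ ^ l₂ := Nat.mul_pos (Nat.pow_pos h2.pos) (Nat.pow_pos h3.pos)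
        obtain ⟨hr, hcop'⟩ := hred _ (ho1.pow.mul ho2.pow) h7
        rw [← hr, two_mul_ordMod_mul_iff h12' hcop' hpos]
        right; right
        refine ⟨h8.2, h9.2, ?_⟩
        rw [h8.2, h9.2, totient_prime_pow_eq_two_mul h2 hq1 h5,
          totient_prime_pow_eq_two_mul h3 hq2 h6, Nat.gcd_mul_left, h10]
  · -- `p` is inert
    rw [residueCard_of_isInertAt (hinert.mp hs), hs]
    have hq : (ordMod n p : ℚ) = 2 * (n.totient : ℚ) / (3 + ((-1 : ℤ) : ℚ)) ↔
        ordMod n p = n.totient := by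
      rw [show (3 + ((-1 : ℤ) : ℚ)) = 2 by norm_num, mul_div_cancel_left₀ _ two_ne_zero]
      exact Nat.cast_inj
    rw [hq]
    constructor
    · intro ho
      obtain ⟨h1, h2, h3⟩ := shape_of_two_mul_ordMod_sq hpn hn hd hd1 hd4 hdn ho
      exact Or.inl ⟨h1, h2, h3.imp id fun h => ⟨h.1, rfl, h.2⟩⟩
    · rintro (⟨h1, ⟨l, hl, h2⟩, h | ⟨h, -, h3⟩⟩ | ⟨q, l, h⟩ | ⟨q₁, q₂, l₁, l₂, h⟩ |
        ⟨q₁, q₂, l₁, l₂, h⟩)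
      · rw [two_mul_ordMod_sq_of_even (h ▸ even_totient (by lia)), h]
      · -- `d < 0` forces `|d| ≡ 3 (mod 4)`, so that the order of `p` is odd
        have hd2 : d.natAbs ≠ 2 := by lia
        have hφ : n.totient = (d.natAbs ^ l).totient := by
          rcases h2 with h2 | h2
          · rw [← h2]
          · rw [h2, totient_two_mul hodd.pow]
        have h4 : ordMod n p = d.natAbs ^ (l - 1) * ((d.natAbs - 1) / 2) := by
          rw [hφ, totient_prime_pow_eq_two_mul h1 hd2 hl] at h; lia
        rw [ordMod_sq_of_odd, h]
        rw [h4, odd_half_totient_iff h1 hd2]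
        lia
      · exact absurd h.2.2.2.2.2.1 (by norm_num)
      · exact absurd h.2.2.2.2.2.2.2.2.2.1 (by norm_num)
      · exact absurd h.2.2.2.2.2.2.2.1 (by norm_num)

end Arithmetic

/-! ### The classification -/

theorem theorem1p3
    -- the quadratic field `K = ℚ(√d)`
    (d : ℤ) (hd : Squarefree d) (hd1 : d ≠ 1)
    (K : Type*) [Field K] [NumberField K]
    (δ : K) (hδ : δ ^ 2 = (d : K)) (hK : IntermediateField.adjoin ℚ {δ} = ⊤)
    -- the nonzero prime ideal `𝔭` and the prime `p` with `pℤ = 𝔭 ∩ ℤ`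
    (𝔭 : Ideal (NumberField.RingOfIntegers K)) [𝔭.IsPrime] (h𝔭 : 𝔭 ≠ ⊥)
    (p : ℕ) [Fact p.Prime] (hp : 𝔭.under ℤ = Ideal.span {(p : ℤ)})
    -- the finite abelian group `G` and the maximal divisor `n` of its exponent with `p ∤ n`
    (G : Type*) [CommGroup G] [Finite G]
    (n : ℕ) (hn : IsGreatest {m : ℕ | m ∣ Monoid.exponent G ∧ ¬ p ∣ m} n) :
    -- 1. `Δ ∤ n`
    (¬ NumberField.discr K ∣ (n : ℤ) →
      (IsCleanRing (MonoidAlgebra (Localization.AtPrime 𝔭) G) ↔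
        ((p = 2 ∧ IsPrimitiveRootMod n p ∧ ¬ NumberField.discr K ≡ 5 [ZMOD 8]) ∨
         (p ≠ 2 ∧ IsPrimitiveRootMod n p ∧
            (legendreSym p (NumberField.discr K) = 1 ∨
              legendreSym p (NumberField.discr K) = 0)) ∨
         ((n = 1 ∨ n = 2) ∧ p ≠ 2 ∧ legendreSym p (NumberField.discr K) = -1) ∨
         (n = 1 ∧ p = 2 ∧ NumberField.discr K ≡ 5 [ZMOD 8])))) ∧
    -- 2. `Δ ∣ n`, `d ≡ 2, 3 (mod 4)`, `d ≠ -1`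
    (NumberField.discr K ∣ (n : ℤ) → (d ≡ 2 [ZMOD 4] ∨ d ≡ 3 [ZMOD 4]) → d ≠ -1 →
      (IsCleanRing (MonoidAlgebra (Localization.AtPrime 𝔭) G) ↔
        (d.natAbs.Prime ∧ (∃ ℓ : ℕ, 1 ≤ ℓ ∧ n = 4 * d.natAbs ^ ℓ) ∧
          p ≡ 3 [MOD 4] ∧ legendreSym p (NumberField.discr K) = 1 ∧
          2 * ordMod n p = n.totient))) ∧
    -- 2'. `Δ ∣ n`, `d = -1`
    (NumberField.discr K ∣ (n : ℤ) → d = -1 →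
      (IsCleanRing (MonoidAlgebra (Localization.AtPrime 𝔭) G) ↔
        ∃ k n₁ : ℕ, Odd n₁ ∧ n = 2 ^ (k + 2) * n₁ ∧
          IsPrimitiveRootMod n₁ p ∧
          ordMod (2 ^ (k + 2)) p = 2 ^ k * ordMod 4 p ∧
          Nat.gcd (ordMod n₁ p) (ordMod (2 ^ (k + 2)) p) = 1)) ∧
    -- 3. `Δ ∣ n`, `d ≡ 1 (mod 4)`
    (NumberField.discr K ∣ (n : ℤ) → d ≡ 1 [ZMOD 4] →
      (IsCleanRing (MonoidAlgebra (Localization.AtPrime 𝔭) G) ↔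
        ( -- (a)
         (d.natAbs.Prime ∧
            (∃ ℓ : ℕ, 1 ≤ ℓ ∧ (n = d.natAbs ^ ℓ ∨ n = 2 * d.natAbs ^ ℓ)) ∧
            ((ordMod n p : ℚ) = 2 * (n.totient : ℚ) / (3 + (primeSym d p : ℚ)) ∨
              (2 * ordMod n p = n.totient ∧ primeSym d p = -1 ∧ d < 0))) ∨
         -- (b)
         (∃ q ℓ : ℕ, d.natAbs = q ∧ q.Prime ∧ 1 ≤ ℓ ∧ n = 4 * q ^ ℓ ∧ q ≡ 3 [MOD 4] ∧
            primeSym d p = 1 ∧ p ≡ 3 [MOD 4] ∧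
            ordMod (q ^ ℓ) p = q ^ (ℓ - 1) * ((q - 1) / 2)) ∨
         -- (c)
         (∃ q₁ q₂ ℓ₁ ℓ₂ : ℕ, d.natAbs = q₁ ∧ q₁.Prime ∧ 1 ≤ ℓ₁ ∧ 1 ≤ ℓ₂ ∧
            (n = q₁ ^ ℓ₁ * q₂ ^ ℓ₂ ∨ n = 2 * (q₁ ^ ℓ₁ * q₂ ^ ℓ₂)) ∧
            q₁ ≡ 3 [MOD 4] ∧ q₂.Prime ∧ Odd q₂ ∧ q₂ ≠ q₁ ∧
            primeSym d p = 1 ∧ IsPrimitiveRootMod (q₂ ^ ℓ₂) p ∧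
            ordMod (q₁ ^ ℓ₁) p = q₁ ^ (ℓ₁ - 1) * ((q₁ - 1) / 2) ∧
            Nat.gcd (q₁ ^ (ℓ₁ - 1) * ((q₁ - 1) / 2)) (q₂ ^ (ℓ₂ - 1) * (q₂ - 1)) = 1) ∨
         -- (d)
         (∃ q₁ q₂ ℓ₁ ℓ₂ : ℕ, d.natAbs = q₁ * q₂ ∧ q₁.Prime ∧ q₂.Prime ∧ q₁ ≠ q₂ ∧
            1 ≤ ℓ₁ ∧ 1 ≤ ℓ₂ ∧
            (n = q₁ ^ ℓ₁ * q₂ ^ ℓ₂ ∨ n = 2 * (q₁ ^ ℓ₁ * q₂ ^ ℓ₂)) ∧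
            primeSym d p = 1 ∧
            IsPrimitiveRootMod (q₁ ^ ℓ₁) p ∧ IsPrimitiveRootMod (q₂ ^ ℓ₂) p ∧
            Nat.gcd (q₁ ^ (ℓ₁ - 1) * ((q₁ - 1) / 2))
              (q₂ ^ (ℓ₂ - 1) * ((q₂ - 1) / 2)) = 1)))) := by
  obtain ⟨hA, hB⟩ := isCleanRing_localization_iff_ordMod hd hd1 hδ hK 𝔭 h𝔭 hp hn
  have hpn : ¬ p ∣ n := hn.1.2
  have hn0 : 0 < n := Nat.pos_of_ne_zero fun h => hpn (h ▸ dvd_zero p)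
  have hdiscr := discr_eq hd hd1 hδ hK
  refine ⟨fun hΔ => ?_, fun hΔ hd4 hdm1 => ?_, fun hΔ hdm1 => ?_, fun hΔ hd4 => ?_⟩
  · rw [hA hΔ]
    exact ordMod_eq_totient_iff_of_linearly_disjoint hpn hn0 _
  · have hd4' : d % 4 = 2 ∨ d % 4 = 3 := hd4
    rw [hB hΔ]
    rw [hdiscr, if_neg (by lia)] at hΔ ⊢
    exact two_mul_ordMod_eq_totient_iff_of_four_mul_dvd hpn hn0 hd hd1 hdm1 hΔ hd4
  · rw [hB hΔ]
    subst hdm1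
    rw [hdiscr, if_neg (by decide)] at hΔ ⊢
    exact two_mul_ordMod_eq_totient_iff_of_four_dvd hpn hn0 (by lia)
  · have hd4' : d % 4 = 1 := hd4
    rw [hB hΔ]
    rw [hdiscr, if_pos hd4'] at hΔ ⊢
    exact two_mul_ordMod_eq_totient_iff_of_dvd hpn hn0 hd hd1 hd4' hΔ
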